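/- Let $k$ be a commutative ring and $H$ a Hopf algebra over $k$ with bijective antipode $S$, projective as a $k$-module. For a right $H$-comodule algebra $A$, with coaction $a\mapsto a_{[0]}\otimes a_{[1]}$, put $A^{{\rm co}H}=\{a\in A\mid a_{[0]}\otimes a_{[1]}=a\otimes 1\}$; call $A$ a right faithfully flat $H$-Galois extension if the map $A\otimes_{A^{{\rm co}H}}A\to A\otimes H$, $a\otimes b\mapsto a_{[0]}b\otimes a_{[1]}$, is bijective and $A$ is faithfully flat as a right $A^{{\rm co}H}$-module. For right $H$-comodule algebras $A,B$, the algebra $B^{\rm op}$ is a left $H$-comodule algebra via $b\mapsto S^{-1}(b_{[1]})\otimes b_{[0]}$, and $A\square_HB^{\rm op}\subseteq A\otimes B^{\rm op}$ is the subalgebra of those $\sum_i a_i\otimes b_i$ with $\sum_i a_{i[0]}\otimes a_{i[1]}\otimes b_i=\sum_i a_i\otimes S^{-1}(b_{i[1]})\otimes b_{i[0]}$; it contains $a\otimes b$ for $a\in A^{{\rm co}H}$, $b\in B^{{\rm co}H}$. A Morita context $(R,T,M,N,\alpha,\beta)$ consists of $k$-algebras $R,T$, bimodules ${}_RM_T$,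 ${}_TN_R$ and bimodule maps $\alpha:M\otimes_TN\to R$, $\beta:N\otimes_RM\to T$ with $\alpha(m\otimes n)m'=m\beta(n\otimes m')$ and $\beta(n\otimes m)n'=n\alpha(m\otimes n')$; it is strict if $\alpha$ and $\beta$ are isomorphisms. Let $A$ and $B$ be right faithfully flat $H$-Galois extensions. A left $A\square_HB^{\rm op}$-module structure on an $(A^{{\rm co}H},B^{{\rm co}H})$-bimodule $M_1$ is always understood to extend the bimodule structure: $(a\otimes b)m=amb$ for $a\in A^{{\rm co}H}$, $b\in B^{{\rm co}H}$. Put $F(M_1)=(A\otimes B^{\rm op})\otimes_{A\square_HB^{\rm op}}M_1$, an $(A,B)$-bimodule, and define $F(N_1)$ likewise for a left $B\square_HA^{\rm op}$-module $N_1$. The map $m\otimes n\mapsto(1\otimes m)\otimes(1\otimes n)$ embeds $M_1\otimes_{B^{{\rm co}H}}N_1$ into the $(A,A)$-bimodule $F(M_1)\otimes_BF(N_1)$ as an $A\square_HA^{\rm op}$-submodule, and $M_1\otimes_{B^{{\rm co}H}}N_1$ carries the resulting left $A\square_HA^{\rm op}$-module structure; $N_1\otimes_{A^{{\rm co}H}}M_1$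 is a left $B\square_HB^{\rm op}$-module in the same way. The algebra $A^{{\rm co}H}$ is a left $A\square_HA^{\rm op}$-module via $(\sum_i a_i\otimes a_i')x=\sum_i a_ixa_i'$, and similarly for $B^{{\rm co}H}$. A $\square_H$-Morita context is a Morita context $(A^{{\rm co}H},B^{{\rm co}H},M_1,N_1,\alpha_1,\beta_1)$ together with a left $A\square_HB^{\rm op}$-module structure on $M_1$ and a left $B\square_HA^{\rm op}$-module structure on $N_1$ such that $\alpha_1$ is left $A\square_HA^{\rm op}$-linear and $\beta_1$ is left $B\square_HB^{\rm op}$-linear. **Theorem.** Let $A$ and $B$ be right faithfully flat $H$-Galois extensions, and let $(A^{{\rm co}H},B^{{\rm co}H},M_1,N_1,\alpha_1,\beta_1)$ be a strict Morita context. Suppose that $M_1$ has a left $A\square_HB^{\rm op}$-module structure. Then there is a unique left $B\square_HA^{\rm op}$-module structure on $N_1$ such that, with the given structure on $M_1$, $(A^{{\rm co}H},B^{{\rm co}H},M_1,N_1,\alpha_1,\beta_1)$ is a strict $\square_H$-Morita context. Moreover, $A$ and $B$ are $H$-Morita equivalent: there is a strict Morita context $(A,B,M,N,\alpha,\beta)$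 and right $H$-comodule structures on $M$ and $N$ with $\rho(amb)=a_{[0]}m_{[0]}b_{[0]}\otimes a_{[1]}m_{[1]}b_{[1]}$ on $M$ and $\rho(bna)=b_{[0]}n_{[0]}a_{[0]}\otimes b_{[1]}n_{[1]}a_{[1]}$ on $N$, such that $\alpha$ and $\beta$ are right $H$-colinear for the coactions $m\otimes n\mapsto m_{[0]}\otimes n_{[0]}\otimes m_{[1]}n_{[1]}$ on $M\otimes_BN$ and $n\otimes m\mapsto n_{[0]}\otimes m_{[0]}\otimes n_{[1]}m_{[1]}$ on $N\otimes_AM$. -/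

import Mathlib

open scoped TensorProduct

universe u

noncomputable section

namespace HopfMorita

/-! ### Balanced tensor products over a (noncommutative) ring

A right action of `R` on `M` and a left action of `R` on `N` are given by the families
`ρ r : M → M`, `m ↦ m r`, and `l r : N → N`, `n ↦ r n`, of `k`-linear maps. -/

section Balanced

variable (k : Type*) [CommRing k] {R M N P : Type*} [AddCommGroup M] [Module k M]
  [AddCommGroup N] [Module k N] [AddCommGroup P] [Module k P]

/-- The `k`-submodule of `M ⊗[k] N` generated by the elements `m r ⊗ n - m ⊗ r n`. -/
def balRel (ρ : R → Module.End k M) (l : R → Module.End k N) : Submodule k (M ⊗[k] N) :=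
  Submodule.span k (Set.range fun p : R × M × N =>
    (ρ p.1 p.2.1) ⊗ₜ[k] p.2.2 - p.2.1 ⊗ₜ[k] (l p.1 p.2.2))

/-- The tensor product `M ⊗_R N`. -/
abbrev BalTensor (ρ : R → Module.End k M) (l : R → Module.End k N) : Type _ :=
  (M ⊗[k] N) ⧸ balRel k ρ l

variable {k}

theorem balRel_le {ρ : R → Module.End k M} {l : R → Module.End k N} {Q : Submodule k (M ⊗[k] N)}
    (h : ∀ r m n, (ρ r m) ⊗ₜ[k] n - m ⊗ₜ[k] (l r n) ∈ Q) : balRel k ρ l ≤ Q := by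
  refine Submodule.span_le.2 ?_
  rintro _ ⟨⟨r, m, n⟩, rfl⟩
  exact h r m n

theorem balRel_mem (ρ : R → Module.End k M) (l : R → Module.End k N) (r : R) (m : M) (n : N) :
    (ρ r m) ⊗ₜ[k] n - m ⊗ₜ[k] (l r n) ∈ balRel k ρ l :=
  Submodule.subset_span ⟨(r, m, n), rfl⟩

/-- The class `m ⊗_R n` of `m ⊗ n`. -/
def BalTensor.tmul (ρ : R → Module.End k M) (l : R → Module.End k N) (m : M) (n : N) :
    BalTensor k ρ l :=
  (balRel k ρ l).mkQ (m ⊗ₜ[k] n)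

theorem BalTensor.smul_tmul (ρ : R → Module.End k M) (l : R → Module.End k N) (r : R) (m : M)
    (n : N) : BalTensor.tmul ρ l (ρ r m) n = BalTensor.tmul ρ l m (l r n) :=
  (Submodule.Quotient.eq _).2 (balRel_mem ρ l r m n)

/-- The map `P ⊗_R N → P ⊗_R N'` induced by an `R`-linear map `N → N'`. -/
def BalTensor.lmap (ρ : R → Module.End k P) {l : R → Module.End k M} {l' : R → Module.End k N}
    (f : M →ₗ[k] N) (hf : ∀ r m, f (l r m) = l' r (f m)) :
    BalTensor k ρ l →ₗ[k] BalTensor k ρ l' :=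
  Submodule.mapQ _ _ (f.lTensor P) <| balRel_le fun r p m => by
    simpa [hf] using balRel_mem ρ l' r p (f m)

end Balanced

/-- A right `R`-module `P` over a `k`-algebra `R` (with right action `ρ`) is faithfully flat: a
sequence of left `R`-modules `N → N' → N''` is exact if and only if
`P ⊗_R N → P ⊗_R N' → P ⊗_R N''` is exact. -/
def RightFaithfullyFlat (k : Type u) [CommRing k] (R : Type u) [Ring R] [Algebra k R]
    {P : Type u} [AddCommGroup P] [Module k P] (ρ : R → Module.End k P) : Prop :=
  ∀ (N N' N'' : Type u) [AddCommGroup N] [AddCommGroup N'] [AddCommGroup N'']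
    [Module k N] [Module k N'] [Module k N''] [Module R N] [Module R N'] [Module R N'']
    [IsScalarTower k R N] [IsScalarTower k R N'] [IsScalarTower k R N'']
    (f : N →ₗ[R] N') (g : N' →ₗ[R] N''),
    Function.Exact f g ↔
      Function.Exact
        (BalTensor.lmap ρ (l := fun r => Algebra.lsmul k k N r)
          (l' := fun r => Algebra.lsmul k k N' r) (f.restrictScalars k) (fun r n => by simp))
        (BalTensor.lmap ρ (l := fun r => Algebra.lsmul k k N' r)
          (l' := fun r => Algebra.lsmul k k N'' r) (g.restrictScalars k) (fun r n => by simp))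

/-! ### Hopf algebras with bijective antipode and comodule algebras -/

/-- The antipode of the Hopf algebra `H` is bijective. -/
class BijectiveAntipode (k H : Type*) [CommRing k] [Ring H] [HopfAlgebra k H] : Prop where
  bijective : Function.Bijective (HopfAlgebra.antipode k : H →ₗ[k] H)

/-- The inverse of the antipode, as an algebra map `Hᵒᵖ → H`. -/
def antipodeInv (k H : Type*) [CommRing k] [Ring H] [HopfAlgebra k H] [BijectiveAntipode k H] :
    Hᵐᵒᵖ →ₐ[k] H :=
  ((AlgEquiv.ofBijective (HopfAlgebra.antipodeAlgHomOp k H)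
    (MulOpposite.op_bijective.comp BijectiveAntipode.bijective)).symm : Hᵐᵒᵖ →ₐ[k] H)

/-- A right `H`-comodule algebra structure on the `k`-algebra `A`: a coassociative and counital
right coaction `a ↦ a₀ ⊗ a₁` that is an algebra map. -/
class ComoduleAlgebra (k H A : Type*) [CommRing k] [Ring H] [HopfAlgebra k H] [Ring A]
    [Algebra k A] where
  coact : A →ₐ[k] A ⊗[k] H
  coassoc : ∀ a, TensorProduct.assoc k A H H (coact.toLinearMap.rTensor H (coact a)) =
    (Coalgebra.comul (R := k) (A := H)).lTensor A (coact a)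
  counit : ∀ a, TensorProduct.rid k A ((Coalgebra.counit (R := k) (A := H)).lTensor A (coact a)) = a

section ComoduleAlgebras

variable (k H A B : Type*) [CommRing k] [Ring H] [HopfAlgebra k H] [Ring A] [Algebra k A]
  [ComoduleAlgebra k H A] [Ring B] [Algebra k B] [ComoduleAlgebra k H B]

/-- The coaction `ρ : A → A ⊗ H`. -/
abbrev coact : A →ₐ[k] A ⊗[k] H := ComoduleAlgebra.coact

/-- The subalgebra of coinvariants `A^{co H} = {a | ρ a = a ⊗ 1}`. -/
def coinv : Subalgebra k A :=
  AlgHom.equalizer (coact k H A) Algebra.TensorProduct.includeLeft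

variable {k H A} in
theorem coact_coinv (a : coinv k H A) : coact k H A (a : A) = (a : A) ⊗ₜ[k] (1 : H) := a.2

/-- The canonical map `A ⊗_{A^{co H}} A → A ⊗ H`, `a ⊗ b ↦ a₀ b ⊗ a₁`. -/
def canMap :
    BalTensor k (fun s : coinv k H A => LinearMap.mulRight k (s : A))
      (fun s : coinv k H A => LinearMap.mulLeft k (s : A)) →ₗ[k] A ⊗[k] H :=
  Submodule.liftQ _
    (LinearMap.mul' k (A ⊗[k] H) ∘ₗ
      TensorProduct.map (coact k H A).toLinearMap
        (Algebra.TensorProduct.includeLeft : A →ₐ[k] A ⊗[k] H).toLinearMap) <|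
    balRel_le fun s a b => by
      simp [LinearMap.mem_ker, coact_coinv, mul_assoc]

/-- `A` is a right faithfully flat `H`-Galois extension of `A^{co H}`: the canonical map
`A ⊗_{A^{co H}} A → A ⊗ H` is bijective, and `A` is faithfully flat as a right
`A^{co H}`-module. -/
structure IsRightFaithfullyFlatGalois (k H A : Type u) [CommRing k] [Ring H] [HopfAlgebra k H]
    [Ring A] [Algebra k A] [ComoduleAlgebra k H A] : Prop where
  can_bijective : Function.Bijective (canMap k H A)
  faithfullyFlat : RightFaithfullyFlat k (coinv k H A)
    (fun s : coinv k H A => LinearMap.mulRight k (s : A))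

variable [BijectiveAntipode k H]

/-- The left `H`-coaction `b ↦ S⁻¹(b₁) ⊗ b₀` on `Bᵒᵖ`. -/
def opCoact : Bᵐᵒᵖ →ₐ[k] H ⊗[k] Bᵐᵒᵖ :=
  (Algebra.TensorProduct.map (antipodeInv k H) (AlgHom.id k Bᵐᵒᵖ)).comp <|
    (Algebra.TensorProduct.comm k Bᵐᵒᵖ Hᵐᵒᵖ : Bᵐᵒᵖ ⊗[k] Hᵐᵒᵖ →ₐ[k] Hᵐᵒᵖ ⊗[k] Bᵐᵒᵖ).comp <|
      ((Algebra.TensorProduct.opAlgEquiv k k B H).symm :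
        (B ⊗[k] H)ᵐᵒᵖ →ₐ[k] Bᵐᵒᵖ ⊗[k] Hᵐᵒᵖ).comp <| (coact k H B).op

/-- The cotensor product `A □_H Bᵒᵖ = {x ∈ A ⊗ Bᵒᵖ | (ρ ⊗ id) x = (id ⊗ λ) x}`, a subalgebra
of `A ⊗ Bᵒᵖ`. -/
def cotensorOp : Subalgebra k (A ⊗[k] Bᵐᵒᵖ) :=
  AlgHom.equalizer
    ((Algebra.TensorProduct.assoc k k k A H Bᵐᵒᵖ :
        (A ⊗[k] H) ⊗[k] Bᵐᵒᵖ →ₐ[k] A ⊗[k] (H ⊗[k] Bᵐᵒᵖ)).comp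
      (Algebra.TensorProduct.map (coact k H A) (AlgHom.id k Bᵐᵒᵖ)))
    (Algebra.TensorProduct.map (AlgHom.id k A) (opCoact k H B))

variable {k H A B}

theorem opCoact_coinv (b : coinv k H B) :
    opCoact k H B (MulOpposite.op (b : B)) = (1 : H) ⊗ₜ[k] MulOpposite.op (b : B) := by
  simp [opCoact, coact_coinv]

theorem tmul_mem_cotensorOp (a : coinv k H A) (b : coinv k H B) :
    (a : A) ⊗ₜ[k] MulOpposite.op (b : B) ∈ cotensorOp k H A B := by
  rw [cotensorOp, AlgHom.mem_equalizer]
  simp [coact_coinv, opCoact_coinv]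

/-- The element `a ⊗ b` of `A □_H Bᵒᵖ`, for `a ∈ A^{co H}` and `b ∈ B^{co H}`. -/
def coinvTmul (a : coinv k H A) (b : coinv k H B) : cotensorOp k H A B :=
  ⟨(a : A) ⊗ₜ[k] MulOpposite.op (b : B), tmul_mem_cotensorOp a b⟩

end ComoduleAlgebras

/-! ### Morita contexts -/

section Morita

variable (k R S M N : Type*) [CommRing k] [Ring R] [Algebra k R] [Ring S] [Algebra k S]
  [AddCommGroup M] [Module k M] [Module R M] [IsScalarTower k R M]
  [Module Sᵐᵒᵖ M] [IsScalarTower k Sᵐᵒᵖ M]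
  [AddCommGroup N] [Module k N] [Module S N] [IsScalarTower k S N]
  [Module Rᵐᵒᵖ N] [IsScalarTower k Rᵐᵒᵖ N]

/-- `M ⊗_S N` for a right `S`-module `M` and a left `S`-module `N`. -/
abbrev TensorOver : Type _ :=
  BalTensor k (fun s : S => Algebra.lsmul k k M (MulOpposite.op s))
    (fun s : S => Algebra.lsmul k k N s)

variable {M N} in
/-- The element `m ⊗_S n` of `M ⊗_S N`. -/
abbrev tmulOver (m : M) (n : N) : TensorOver k S M N := BalTensor.tmul _ _ m n

/-- A Morita context `(R, S, M, N, α, β)`: here `M` is an `(R, S)`-bimodule, `N` is an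
`(S, R)`-bimodule, and `α : M ⊗_S N → R` and `β : N ⊗_R M → S` are bimodule maps with
`α(m ⊗ n) m' = m β(n ⊗ m')` and `β(n ⊗ m) n' = n α(m ⊗ n')`. -/
structure MoritaContext [SMulCommClass R Sᵐᵒᵖ M] [SMulCommClass S Rᵐᵒᵖ N] where
  α : TensorOver k S M N →ₗ[k] R
  β : TensorOver k R N M →ₗ[k] S
  α_left : ∀ (r : R) (m : M) (n : N), α (tmulOver k S (r • m) n) = r * α (tmulOver k S m n)
  α_right : ∀ (r : R) (m : M) (n : N),
    α (tmulOver k S m (MulOpposite.op r • n)) = α (tmulOver k S m n) * r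
  β_left : ∀ (s : S) (n : N) (m : M), β (tmulOver k R (s • n) m) = s * β (tmulOver k R n m)
  β_right : ∀ (s : S) (n : N) (m : M),
    β (tmulOver k R n (MulOpposite.op s • m)) = β (tmulOver k R n m) * s
  α_β : ∀ (m : M) (n : N) (m' : M),
    α (tmulOver k S m n) • m' = MulOpposite.op (β (tmulOver k R n m')) • m
  β_α : ∀ (n : N) (m : M) (n' : N),
    β (tmulOver k R n m) • n' = MulOpposite.op (α (tmulOver k S m n')) • n

variable {k R S M N} in
/-- A Morita context is strict if both connecting maps are isomorphisms. -/
def MoritaContext.IsStrict [SMulCommClass R Sᵐᵒᵖ M] [SMulCommClass S Rᵐᵒᵖ N]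
    (X : MoritaContext k R S M N) : Prop :=
  Function.Bijective X.α ∧ Function.Bijective X.β

end Morita

/-! ### Relative Hopf bimodules and `H`-Morita contexts -/

section HopfBimodules

variable (k H A B M N : Type*) [CommRing k] [Ring H] [HopfAlgebra k H] [Ring A] [Algebra k A]
  [ComoduleAlgebra k H A] [Ring B] [Algebra k B] [ComoduleAlgebra k H B]
  [AddCommGroup M] [Module k M] [Module A M] [IsScalarTower k A M]
  [Module Bᵐᵒᵖ M] [IsScalarTower k Bᵐᵒᵖ M]
  [AddCommGroup N] [Module k N] [Module B N] [IsScalarTower k B N]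
  [Module Aᵐᵒᵖ N] [IsScalarTower k Aᵐᵒᵖ N]

/-- The map `(A ⊗ H) × (M ⊗ H) → M ⊗ H`, `(a ⊗ h, m ⊗ h') ↦ a m ⊗ h h'`. -/
def leftMulH : A ⊗[k] H →ₗ[k] M ⊗[k] H →ₗ[k] M ⊗[k] H :=
  TensorProduct.map₂ (Algebra.lsmul k k M : A →ₐ[k] Module.End k M).toLinearMap (LinearMap.mul k H)

/-- The map `(B ⊗ H) × (M ⊗ H) → M ⊗ H`, `(b ⊗ h, m ⊗ h') ↦ m b ⊗ h' h`. -/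
def rightMulH : B ⊗[k] H →ₗ[k] M ⊗[k] H →ₗ[k] M ⊗[k] H :=
  TensorProduct.map₂
    ((Algebra.lsmul k k M : Bᵐᵒᵖ →ₐ[k] Module.End k M).toLinearMap ∘ₗ
      (MulOpposite.opLinearEquiv k : B ≃ₗ[k] Bᵐᵒᵖ).toLinearMap)
    (LinearMap.mul k H).flip

/-- A right `H`-coaction on the `(A, B)`-bimodule `M` making it a two-sided relative Hopf module,
an object of `_A M_B^H`: `ρ(a m b) = a₀ m₀ b₀ ⊗ a₁ m₁ b₁`. -/
class RelHopfBimodule [SMulCommClass A Bᵐᵒᵖ M] where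
  coact : M →ₗ[k] M ⊗[k] H
  coassoc : ∀ m, TensorProduct.assoc k M H H (coact.rTensor H (coact m)) =
    (Coalgebra.comul (R := k) (A := H)).lTensor M (coact m)
  counit : ∀ m, TensorProduct.rid k M ((Coalgebra.counit (R := k) (A := H)).lTensor M (coact m)) = m
  coact_left : ∀ (a : A) (m : M),
    coact (a • m) = leftMulH k H A M (HopfMorita.coact k H A a) (coact m)
  coact_right : ∀ (b : B) (m : M),
    coact (MulOpposite.op b • m) = rightMulH k H B M (HopfMorita.coact k H B b) (coact m)

variable {k H M N} in
/-- The diagonal map `M ⊗ N → (M ⊗ N) ⊗ H`, `m ⊗ n ↦ (m₀ ⊗ n₀) ⊗ m₁ n₁`, for two maps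
`M → M ⊗ H` and `N → N ⊗ H`. -/
def diagCoact (ρM : M →ₗ[k] M ⊗[k] H) (ρN : N →ₗ[k] N ⊗[k] H) :
    M ⊗[k] N →ₗ[k] (M ⊗[k] N) ⊗[k] H :=
  (LinearMap.mul' k H).lTensor (M ⊗[k] N) ∘ₗ
    (TensorProduct.tensorTensorTensorComm k M H N H).toLinearMap ∘ₗ TensorProduct.map ρM ρN

variable {A B M N} in
/-- The Morita context `(A, B, M, N, α, β)` is an `H`-Morita context: `M` and `N` are two-sided
relative Hopf modules, and `α` and `β` are right `H`-colinear for the diagonal coactions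
`m ⊗ n ↦ m₀ ⊗ n₀ ⊗ m₁ n₁` on `M ⊗_B N` and `n ⊗ m ↦ n₀ ⊗ m₀ ⊗ n₁ m₁` on `N ⊗_A M`. -/
structure MoritaContext.IsHMorita [SMulCommClass A Bᵐᵒᵖ M] [SMulCommClass B Aᵐᵒᵖ N]
    [RelHopfBimodule k H A B M] [RelHopfBimodule k H B A N]
    (X : MoritaContext k A B M N) : Prop where
  α_colinear : ∀ x : M ⊗[k] N,
    coact k H A (X.α ((balRel k _ _).mkQ x)) =
      (X.α ∘ₗ (balRel k _ _).mkQ).rTensor H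
        (diagCoact (RelHopfBimodule.coact A B : M →ₗ[k] M ⊗[k] H)
          (RelHopfBimodule.coact B A : N →ₗ[k] N ⊗[k] H) x)
  β_colinear : ∀ x : N ⊗[k] M,
    coact k H B (X.β ((balRel k _ _).mkQ x)) =
      (X.β ∘ₗ (balRel k _ _).mkQ).rTensor H
        (diagCoact (RelHopfBimodule.coact B A : N →ₗ[k] N ⊗[k] H)
          (RelHopfBimodule.coact A B : M →ₗ[k] M ⊗[k] H) x)

end HopfBimodules

/-- `A` and `B` are `H`-Morita equivalent: they are connected by a strict `H`-Morita context. -/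
def HMoritaEquivalent (k H A B : Type u) [CommRing k] [Ring H] [HopfAlgebra k H]
    [Ring A] [Algebra k A] [ComoduleAlgebra k H A] [Ring B] [Algebra k B]
    [ComoduleAlgebra k H B] : Prop :=
  ∃ (M N : Type u) (_ : AddCommGroup M) (_ : Module k M) (_ : Module A M) (_ : IsScalarTower k A M)
    (_ : Module Bᵐᵒᵖ M) (_ : IsScalarTower k Bᵐᵒᵖ M) (_ : SMulCommClass A Bᵐᵒᵖ M)
    (_ : AddCommGroup N) (_ : Module k N) (_ : Module B N) (_ : IsScalarTower k B N)
    (_ : Module Aᵐᵒᵖ N) (_ : IsScalarTower k Aᵐᵒᵖ N) (_ : SMulCommClass B Aᵐᵒᵖ N)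
    (_ : RelHopfBimodule k H A B M) (_ : RelHopfBimodule k H B A N)
    (X : MoritaContext k A B M N), X.IsHMorita k H ∧ X.IsStrict

/-! ### Modules over the cotensor product and `□_H`-Morita contexts -/

/-- A left `A □_H Bᵒᵖ`-module structure on `M₁` extending its
`(A^{co H}, B^{co H})`-bimodule structure. -/
@[ext]
structure BoxModule (k H A B M₁ : Type*) [CommRing k] [Ring H] [HopfAlgebra k H]
    [BijectiveAntipode k H] [Ring A] [Algebra k A] [ComoduleAlgebra k H A]
    [Ring B] [Algebra k B] [ComoduleAlgebra k H B] [AddCommGroup M₁] [Module k M₁]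
    [Module (coinv k H A) M₁] [Module (coinv k H B)ᵐᵒᵖ M₁] where
  act : cotensorOp k H A B →ₐ[k] Module.End k M₁
  act_coinv : ∀ (a : coinv k H A) (b : coinv k H B) (m : M₁),
    act (coinvTmul a b) m = a • (MulOpposite.op b • m)

section Box

variable {k H A B C M₁ N₁ : Type*} [CommRing k] [Ring H] [HopfAlgebra k H]
  [BijectiveAntipode k H] [Ring A] [Algebra k A] [ComoduleAlgebra k H A]
  [Ring B] [Algebra k B] [ComoduleAlgebra k H B] [Ring C] [Algebra k C] [ComoduleAlgebra k H C]
  [AddCommGroup M₁] [Module k M₁] [Module (coinv k H A) M₁] [Module (coinv k H B)ᵐᵒᵖ M₁]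
  [AddCommGroup N₁] [Module k N₁] [Module (coinv k H B) N₁] [Module (coinv k H C)ᵐᵒᵖ N₁]

/-- The induced module `F(M₁) = (A ⊗ Bᵒᵖ) ⊗_{A □_H Bᵒᵖ} M₁`. -/
abbrev BoxModule.Ind (μ : BoxModule k H A B M₁) : Type _ :=
  BalTensor k (fun t : cotensorOp k H A B => LinearMap.mulRight k (t : A ⊗[k] Bᵐᵒᵖ))
    (fun t : cotensorOp k H A B => μ.act t)

/-- The left action of `x ∈ A ⊗ Bᵒᵖ` on `F(M₁)`, that is, the `(A, B)`-bimodule structure. -/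
def BoxModule.indAct (μ : BoxModule k H A B M₁) (x : A ⊗[k] Bᵐᵒᵖ) : Module.End k μ.Ind :=
  Submodule.mapQ _ _ ((LinearMap.mulLeft k x).rTensor M₁) <| balRel_le fun t y m => by
    simpa [mul_assoc] using balRel_mem
      (fun t : cotensorOp k H A B => LinearMap.mulRight k (t : A ⊗[k] Bᵐᵒᵖ))
      (fun t : cotensorOp k H A B => μ.act t) t (x * y) m

/-- The unit `η : M₁ → F(M₁)`, `m ↦ (1 ⊗ 1) ⊗ m`. -/
def BoxModule.unit (μ : BoxModule k H A B M₁) : M₁ →ₗ[k] μ.Ind :=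
  (balRel k _ _).mkQ ∘ₗ TensorProduct.mk k (A ⊗[k] Bᵐᵒᵖ) M₁ 1

theorem BoxModule.indAct_unit (μ : BoxModule k H A B M₁) (t : cotensorOp k H A B) (m : M₁) :
    μ.indAct t (μ.unit m) = μ.unit (μ.act t m) := by
  have h := BalTensor.smul_tmul
    (fun t : cotensorOp k H A B => LinearMap.mulRight k (t : A ⊗[k] Bᵐᵒᵖ))
    (fun t : cotensorOp k H A B => μ.act t) t 1 m
  simpa [BoxModule.indAct, BoxModule.unit, BalTensor.tmul] using h

theorem BoxModule.indAct_mul (μ : BoxModule k H A B M₁) (x y : A ⊗[k] Bᵐᵒᵖ) (z : μ.Ind) :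
    μ.indAct (x * y) z = μ.indAct x (μ.indAct y z) := by
  obtain ⟨z, rfl⟩ := Submodule.mkQ_surjective _ z
  induction z with
  | zero => simp
  | add a b ha hb => simp only [map_add, ha, hb]
  | tmul a m => simp [BoxModule.indAct]

/-- The left action of `x ∈ A ⊗ Bᵒᵖ` on `F(M₁)` as a linear function of `x`. -/
def BoxModule.indActₗ (μ : BoxModule k H A B M₁) : A ⊗[k] Bᵐᵒᵖ →ₗ[k] Module.End k μ.Ind where
  toFun := μ.indAct
  map_add' x y := by
    ext a b m
    simp [BoxModule.indAct, add_mul, TensorProduct.add_tmul]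
  map_smul' c x := by
    ext a b m
    simp only [BoxModule.indAct, LinearMap.comp_apply, TensorProduct.AlgebraTensorModule.curry_apply,
      LinearMap.restrictScalars_self, TensorProduct.curry_apply, Submodule.mkQ_apply,
      Submodule.mapQ_apply, LinearMap.rTensor_tmul, LinearMap.mulLeft_apply, smul_mul_assoc,
      RingHom.id_apply, LinearMap.smul_apply, ← Submodule.Quotient.mk_smul,
      TensorProduct.smul_tmul']

/-- The tensor product `F(M₁) ⊗_B F(N₁)`. -/
abbrev IndTensor (μ : BoxModule k H A B M₁) (ν : BoxModule k H B C N₁) : Type _ :=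
  BalTensor k (fun b : B => μ.indAct (1 ⊗ₜ[k] MulOpposite.op b))
    (fun b : B => ν.indAct (b ⊗ₜ[k] 1))

/-- The left action of `A ⊗ Cᵒᵖ` on `F(M₁) ⊗_B F(N₁)`, that is, the `(A, C)`-bimodule structure:
`(a ⊗ c)(m ⊗ n) = a m ⊗ n c`. -/
def indTensorAct (μ : BoxModule k H A B M₁) (ν : BoxModule k H B C N₁) (x : A ⊗[k] Cᵐᵒᵖ) :
    Module.End k (IndTensor μ ν) :=
  Submodule.mapQ _ _
    (TensorProduct.map₂
      (μ.indActₗ ∘ₗ (Algebra.TensorProduct.includeLeft : A →ₐ[k] A ⊗[k] Bᵐᵒᵖ).toLinearMap)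
      (ν.indActₗ ∘ₗ (Algebra.TensorProduct.includeRight : Cᵐᵒᵖ →ₐ[k] B ⊗[k] Cᵐᵒᵖ).toLinearMap)
      x) <| balRel_le fun b m n => by
    rw [Submodule.mem_comap]
    induction x with
    | zero => simp
    | add x y hx hy =>
      rw [map_add, LinearMap.add_apply]
      exact add_mem hx hy
    | tmul a c =>
      have h := balRel_mem (fun b : B => μ.indAct (1 ⊗ₜ[k] MulOpposite.op b))
        (fun b : B => ν.indAct (b ⊗ₜ[k] 1)) b (μ.indAct (a ⊗ₜ[k] 1) m) (ν.indAct (1 ⊗ₜ[k] c) n)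
      rw [← BoxModule.indAct_mul, ← BoxModule.indAct_mul] at h
      simpa [BoxModule.indActₗ, ← BoxModule.indAct_mul] using h

variable [IsScalarTower k (coinv k H B)ᵐᵒᵖ M₁] [IsScalarTower k (coinv k H B) N₁]

/-- The map `M₁ ⊗_{B^{co H}} N₁ → F(M₁) ⊗_B F(N₁)`, `m ⊗ n ↦ η(m) ⊗_B η(n)`. If `A` and `B` are
right faithfully flat `H`-Galois extensions, it is an isomorphism onto the coinvariants
`(F(M₁) ⊗_B F(N₁))^{co H}`. -/
def unitTensor (μ : BoxModule k H A B M₁) (ν : BoxModule k H B C N₁) :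
    TensorOver k (coinv k H B) M₁ N₁ →ₗ[k] IndTensor μ ν :=
  Submodule.mapQ _ _ (TensorProduct.map μ.unit ν.unit) <| balRel_le fun b m n => by
    have h := balRel_mem (fun b : B => μ.indAct (1 ⊗ₜ[k] MulOpposite.op b))
      (fun b : B => ν.indAct (b ⊗ₜ[k] 1)) b (μ.unit m) (ν.unit n)
    have h₁ := μ.indAct_unit (coinvTmul 1 b) m
    have h₂ := ν.indAct_unit (coinvTmul b 1) n
    rw [BoxModule.act_coinv] at h₁ h₂
    simp only [coinvTmul, OneMemClass.coe_one, MulOpposite.op_one, one_smul] at h₁ h₂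
    rw [h₁, h₂] at h
    simpa using h

/-- The left `A □_H Cᵒᵖ`-module structure `τ` on `M₁ ⊗_{B^{co H}} N₁` is the one transported from
`(F(M₁) ⊗_B F(N₁))^{co H} ⊆ F(M₁) ⊗_B F(N₁)` along the map `m ⊗ n ↦ η(m) ⊗_B η(n)`. -/
structure IsTensorAction (μ : BoxModule k H A B M₁) (ν : BoxModule k H B C N₁)
    (τ : cotensorOp k H A C →ₐ[k] Module.End k (TensorOver k (coinv k H B) M₁ N₁)) : Prop where
  injective : Function.Injective (unitTensor μ ν)
  map_act : ∀ (t : cotensorOp k H A C) (x : TensorOver k (coinv k H B) M₁ N₁),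
    unitTensor μ ν (τ t x) = indTensorAct μ ν t (unitTensor μ ν x)

end Box

section BoxMorita

variable {k H A B M₁ N₁ : Type*} [CommRing k] [Ring H] [HopfAlgebra k H]
  [BijectiveAntipode k H] [Ring A] [Algebra k A] [ComoduleAlgebra k H A]
  [Ring B] [Algebra k B] [ComoduleAlgebra k H B]
  [AddCommGroup M₁] [Module k M₁] [Module (coinv k H A) M₁] [IsScalarTower k (coinv k H A) M₁]
  [Module (coinv k H B)ᵐᵒᵖ M₁] [IsScalarTower k (coinv k H B)ᵐᵒᵖ M₁]
  [AddCommGroup N₁] [Module k N₁] [Module (coinv k H B) N₁] [IsScalarTower k (coinv k H B) N₁]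
  [Module (coinv k H A)ᵐᵒᵖ N₁] [IsScalarTower k (coinv k H A)ᵐᵒᵖ N₁]

/-- The map `α : M₁ ⊗_{B^{co H}} N₁ → A^{co H}` is left `A □_H Aᵒᵖ`-linear, where
`M₁ ⊗_{B^{co H}} N₁` carries the transported module structure and `A^{co H}` carries the structure
`(∑ aᵢ ⊗ aᵢ') x = ∑ aᵢ x aᵢ'`. -/
def IsBoxLinear (μ : BoxModule k H A B M₁) (ν : BoxModule k H B A N₁)
    (α : TensorOver k (coinv k H B) M₁ N₁ →ₗ[k] coinv k H A) : Prop :=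
  ∃ τ : cotensorOp k H A A →ₐ[k] Module.End k (TensorOver k (coinv k H B) M₁ N₁),
    IsTensorAction μ ν τ ∧
      ∀ (t : cotensorOp k H A A) (x : TensorOver k (coinv k H B) M₁ N₁),
        (α (τ t x) : A) = AlgHom.mulLeftRight k A t (α x : A)

/-- The Morita context `(A^{co H}, B^{co H}, M₁, N₁, α₁, β₁)`, together with the left
`A □_H Bᵒᵖ`-module structure `μ` on `M₁` and the left `B □_H Aᵒᵖ`-module structure `ν` on `N₁`,
is a `□_H`-Morita context. -/
structure MoritaContext.IsBoxMorita [SMulCommClass (coinv k H A) (coinv k H B)ᵐᵒᵖ M₁]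
    [SMulCommClass (coinv k H B) (coinv k H A)ᵐᵒᵖ N₁]
    (X : MoritaContext k (coinv k H A) (coinv k H B) M₁ N₁)
    (μ : BoxModule k H A B M₁) (ν : BoxModule k H B A N₁) : Prop where
  α_linear : IsBoxLinear μ ν X.α
  β_linear : IsBoxLinear ν μ X.β

end BoxMorita

end HopfMorita

end

/-!
The argument is carried out on the induced bimodules. Let `Λ = A ⊗ Bᵒᵖ` and `T = A □_H Bᵒᵖ`. A map
`V → V ⊗ H` compatible with a `Λ`-action on `V` is a linear map for the diagonal action of `Λ` on
`V ⊗ H` (`biDiag`). Since the antipode is bijective, `T` is the space of coinvariants of `Λ` for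
`a ⊗ b ↦ a₀ ⊗ b₀ ⊗ a₁ b₁` (`mem_cotensorOp_iff`). The structure theorem for relative Hopf modules
(`coinvMul_bijective`), proved from the canonical isomorphism and flatness, then gives
`A ⊗_{A^{co H}} T ≃ Λ`. Consequently `F(M₁) = Λ ⊗_T M₁` has the universal property of
`A ⊗_{A^{co H}} M₁` (`BoxModule.exists_ind_lift`): left `A`-linear maps out of it are the same as
left `A^{co H}`-linear maps out of `M₁`.

Each `n : N₁` gives a left `A`-linear and colinear map `F(M₁) → A` that extends `m ↦ α(m ⊗ n)`
(`pairHom`). As the context is strict, `N₁` is the dual of `M₁`, so that these maps are exactly the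
left `A`-linear maps `F(M₁) → A` that take `M₁` to `A^{co H}`. The algebra `B ⊗ Aᵒᵖ` acts on
`Hom(F(M₁), A)` by `(b g a)(z) = g(z b) a`, and the cotensor product `B □_H Aᵒᵖ` stabilizes the
image of `N₁` (`exists_homAct_pairHom`). This is the required action on `N₁`; an action on `N₁` that
agrees with it is called `DualCompatible`.

For a dual compatible action, `α` extends to a pairing of `F(N₁)` and `F(M₁)` with values in `A`
that is bilinear for all the bimodule structures (`indPair`). Dual compatibility is symmetric in `M₁`
and `N₁` (`DualCompatible.swap`). This is where the projectivity of `H` enters: the identity to be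
proved holds after acting on `F(M₁)` from the right, and `B` acts faithfully on `F(M₁)` because the
annihilator is a subcomodule and thus generated by its coinvariants (`eq_zero_of_indHom_right`). By
symmetry `β` extends as well, and the two extended pairings satisfy the associativity conditions
(`indHom_indPair`). They form a strict `H`-Morita context (`hMoritaEquivalent_of_dualCompatible`).

Since the extension `F(M₁) ⊗_B F(N₁) → A` of `α` is a bijective bimodule map, `M₁ ⊗ N₁` is stable
under `A □_H Aᵒᵖ` in `F(M₁) ⊗_B F(N₁)` and `α` is linear (`isBoxLinear_of_dualCompatible`).
Conversely, if `α` is linear over `A □_H Aᵒᵖ`, then its left `A`-linear extension to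
`F(M₁) ⊗_B F(N₁)` is also right `A`-linear, as `A ⊗ Aᵒᵖ` is generated by `A ⊗ 1` and `A □_H Aᵒᵖ`.
This forces the action on `N₁` to be dual compatible (`dualCompatible_of_isBoxLinear`), and a dual
compatible action is unique because `N₁ → Hom(F(M₁), A)` is injective.
-/

noncomputable section

namespace HopfMorita

/-! ### Balanced tensor products: maps out of them -/

section BalancedMaps

variable {k : Type*} [CommRing k] {R M N P : Type*} [AddCommGroup M] [Module k M]
  [AddCommGroup N] [Module k N] [AddCommGroup P] [Module k P]

/-- The linear map `M ⊗_R N → P` induced by an `R`-balanced bilinear map. -/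
def BalTensor.lift {ρ : R → Module.End k M} {l : R → Module.End k N} (b : M →ₗ[k] N →ₗ[k] P)
    (hb : ∀ r m n, b (ρ r m) n = b m (l r n)) : BalTensor k ρ l →ₗ[k] P :=
  Submodule.liftQ _ (TensorProduct.lift b) <| balRel_le fun r m n => by
    simp [LinearMap.mem_ker, hb]

@[simp]
theorem BalTensor.lift_tmul {ρ : R → Module.End k M} {l : R → Module.End k N}
    (b : M →ₗ[k] N →ₗ[k] P) (hb : ∀ r m n, b (ρ r m) n = b m (l r n)) (m : M) (n : N) :
    BalTensor.lift b hb (BalTensor.tmul ρ l m n) = b m n := by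
  simp [BalTensor.lift, BalTensor.tmul]

@[simp]
theorem BalTensor.lmap_tmul (ρ : R → Module.End k P) {l : R → Module.End k M}
    {l' : R → Module.End k N} (f : M →ₗ[k] N) (hf : ∀ r m, f (l r m) = l' r (f m)) (p : P) (m : M) :
    BalTensor.lmap ρ f hf (BalTensor.tmul ρ l p m) = BalTensor.tmul ρ l' p (f m) := by
  simp [BalTensor.lmap, BalTensor.tmul]

theorem BalTensor.hom_ext {ρ : R → Module.End k M} {l : R → Module.End k N}
    {f g : BalTensor k ρ l →ₗ[k] P}
    (h : ∀ m n, f (BalTensor.tmul ρ l m n) = g (BalTensor.tmul ρ l m n)) : f = g := by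
  refine Submodule.linearMap_qext _ (TensorProduct.ext' fun m n => h m n)

theorem BalTensor.induction {ρ : R → Module.End k M} {l : R → Module.End k N}
    {p : BalTensor k ρ l → Prop} (zero : p 0) (tmul : ∀ m n, p (BalTensor.tmul ρ l m n))
    (add : ∀ x y, p x → p y → p (x + y)) (x : BalTensor k ρ l) : p x := by
  obtain ⟨z, rfl⟩ := Submodule.mkQ_surjective _ x
  induction z with
  | zero => simpa using zero
  | add a b ha hb => simpa only [map_add] using add _ _ ha hb
  | tmul m n => exact tmul m n

/-- `m ⊗_R n` as a bilinear function of `m` and `n`. -/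
def BalTensor.mk (ρ : R → Module.End k M) (l : R → Module.End k N) :
    M →ₗ[k] N →ₗ[k] BalTensor k ρ l :=
  (TensorProduct.mk k M N).compr₂ (balRel k ρ l).mkQ

@[simp]
theorem BalTensor.mk_apply (ρ : R → Module.End k M) (l : R → Module.End k N) (m : M) (n : N) :
    BalTensor.mk ρ l m n = BalTensor.tmul ρ l m n := rfl

theorem BalTensor.tmul_add (ρ : R → Module.End k M) (l : R → Module.End k N) (m : M) (n n' : N) :
    BalTensor.tmul ρ l m (n + n') = BalTensor.tmul ρ l m n + BalTensor.tmul ρ l m n' :=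
  map_add (BalTensor.mk ρ l m) n n'

theorem BalTensor.tmul_smul (ρ : R → Module.End k M) (l : R → Module.End k N) (c : k) (m : M)
    (n : N) : BalTensor.tmul ρ l m (c • n) = c • BalTensor.tmul ρ l m n :=
  map_smul (BalTensor.mk ρ l m) c n

end BalancedMaps

/-! ### Flatness in terms of actions given by algebra maps -/

section Flat

/-- The restriction of an action `R → End V` to a stable submodule. -/
def restrictAct {k R V : Type*} [CommRing k] [Ring R] [Algebra k R] [AddCommGroup V] [Module k V]
    (l : R →ₐ[k] Module.End k V) (C : Submodule k V) (hC : ∀ r, ∀ v ∈ C, l r v ∈ C) :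
    R →ₐ[k] Module.End k C :=
  AlgHom.ofLinearMap
    { toFun := fun r => (l r).restrict (hC r)
      map_add' := fun r s => by ext; simp
      map_smul' := fun c r => by ext; simp }
    (by ext; simp) (fun r s => by ext; simp)

@[simp]
theorem restrictAct_apply_coe {k R V : Type*} [CommRing k] [Ring R] [Algebra k R] [AddCommGroup V]
    [Module k V] (l : R →ₐ[k] Module.End k V) (C : Submodule k V)
    (hC : ∀ r, ∀ v ∈ C, l r v ∈ C) (r : R) (v : C) :
    (restrictAct l C hC r v : V) = l r v := rfl

variable {k : Type u} [CommRing k] {R : Type u} [Ring R] [Algebra k R]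
    {P : Type u} [AddCommGroup P] [Module k P] {ρ : R → Module.End k P}

theorem RightFaithfullyFlat.exact_lmap (h : RightFaithfullyFlat k R ρ)
    {N N' N'' : Type u} [AddCommGroup N] [AddCommGroup N'] [AddCommGroup N'']
    [Module k N] [Module k N'] [Module k N''] {l : R →ₐ[k] Module.End k N}
    {l' : R →ₐ[k] Module.End k N'} {l'' : R →ₐ[k] Module.End k N''}
    (f : N →ₗ[k] N') (g : N' →ₗ[k] N'') (hf : ∀ r n, f (l r n) = l' r (f n))
    (hg : ∀ r n, g (l' r n) = l'' r (g n)) (hfg : Function.Exact f g) :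
    Function.Exact (BalTensor.lmap ρ (l := l) (l' := l') f hf)
      (BalTensor.lmap ρ (l := l') (l' := l'') g hg) := by
  let _ : Module R N := Module.compHom N l.toRingHom
  let _ : Module R N' := Module.compHom N' l'.toRingHom
  let _ : Module R N'' := Module.compHom N'' l''.toRingHom
  have _ : IsScalarTower k R N := ⟨fun c r n => by
    change l (c • r) n = c • l r n; simp⟩
  have _ : IsScalarTower k R N' := ⟨fun c r n => by
    change l' (c • r) n = c • l' r n; simp⟩
  have _ : IsScalarTower k R N'' := ⟨fun c r n => by
    change l'' (c • r) n = c • l'' r n; simp⟩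
  let f' : N →ₗ[R] N' := { f with map_smul' := hf }
  let g' : N' →ₗ[R] N'' := { g with map_smul' := hg }
  exact (h N N' N'' f' g').1 hfg

theorem RightFaithfullyFlat.lmap_injective (h : RightFaithfullyFlat k R ρ)
    {N N' : Type u} [AddCommGroup N] [AddCommGroup N']
    [Module k N] [Module k N'] {l : R →ₐ[k] Module.End k N} {l' : R →ₐ[k] Module.End k N'}
    (f : N →ₗ[k] N') (hf : ∀ r n, f (l r n) = l' r (f n)) (hinj : Function.Injective f) :
    Function.Injective (BalTensor.lmap ρ (l := l) (l' := l') f hf) := by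
  have h0 (r : R) (n : N) : (0 : N →ₗ[k] N) (l r n) = l r ((0 : N →ₗ[k] N) n) := by simp
  have hex := h.exact_lmap (l := l) (l' := l) (l'' := l') (0 : N →ₗ[k] N) f h0 hf (by
    intro x
    simpa [eq_comm] using map_eq_zero_iff f hinj)
  refine (injective_iff_map_eq_zero _).2 fun x hx => ?_
  obtain ⟨y, rfl⟩ := (hex x).1 hx
  clear hx
  induction y using BalTensor.induction with
  | zero => simp
  | add x y hx hy => simp only [map_add, hx, hy, add_zero]
  | tmul p n =>
    rw [BalTensor.lmap_tmul, LinearMap.zero_apply, ← BalTensor.mk_apply, map_zero]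

end Flat

/-! ### Relative Hopf modules and the structure theorem -/

section Structure

variable {k H A V W : Type*} [CommRing k] [Ring H] [HopfAlgebra k H] [Ring A] [Algebra k A]
  [AddCommGroup V] [Module k V] [AddCommGroup W] [Module k W]

/-- The action `(a ⊗ h)(v ⊗ g) = a v ⊗ h g` of `A ⊗ H` on `V ⊗ H`, where `L` is an action of `A`
on `V`. -/
def actH (H : Type*) [Ring H] [HopfAlgebra k H] (L : A →ₐ[k] Module.End k V) :
    A ⊗[k] H →ₐ[k] Module.End k (V ⊗[k] H) :=
  (Module.endTensorEndAlgHom (R := k) (S := k) (A := k)).comp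
    (Algebra.TensorProduct.map L (Algebra.lmul k H))

@[simp]
theorem actH_tmul (L : A →ₐ[k] Module.End k V) (a : A) (h : H) (v : V) (g : H) :
    actH H L (a ⊗ₜ h) (v ⊗ₜ g) = L a v ⊗ₜ (h * g) := by
  simp [actH, Module.endTensorEndAlgHom_apply]

/-- The action of `A ⊗ H` is natural in `V`. -/
theorem rTensor_actH (L : A →ₐ[k] Module.End k V) (L' : A →ₐ[k] Module.End k W) (θ : V →ₗ[k] W)
    (hθ : ∀ a v, θ (L a v) = L' a (θ v)) (p : A ⊗[k] H) (z : V ⊗[k] H) :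
    θ.rTensor H (actH H L p z) = actH H L' p (θ.rTensor H z) := by
  induction p with
  | zero => simp
  | add p q hp hq => simp [hp, hq]
  | tmul a h =>
    induction z with
    | zero => simp
    | add p q hp hq => simp [hp, hq]
    | tmul v g => simp [hθ]

variable [ComoduleAlgebra k H A]

/-- The diagonal action `a (v ⊗ g) = a₀ v ⊗ a₁ g` of `A` on `V ⊗ H`. -/
def diagAct (H : Type*) [Ring H] [HopfAlgebra k H] [ComoduleAlgebra k H A]
    (L : A →ₐ[k] Module.End k V) : A →ₐ[k] Module.End k (V ⊗[k] H) :=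
  (actH H L).comp (coact k H A)

theorem diagAct_apply (L : A →ₐ[k] Module.End k V) (a : A) :
    diagAct H L a = actH H L (coact k H A a) := rfl

theorem diagAct_coinv (L : A →ₐ[k] Module.End k V) (a : coinv k H A) (v : V) (g : H) :
    diagAct H L (a : A) (v ⊗ₜ g) = L a v ⊗ₜ g := by
  simp [diagAct, coact_coinv]

/-- The restriction to `A^{co H}` of an action of `A`. -/
def coinvAct (H : Type*) [Ring H] [HopfAlgebra k H] [ComoduleAlgebra k H A]
    (L : A →ₐ[k] Module.End k V) : coinv k H A →ₐ[k] Module.End k V :=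
  L.comp (coinv k H A).val

@[simp]
theorem coinvAct_apply (L : A →ₐ[k] Module.End k V) (a : coinv k H A) (v : V) :
    coinvAct H L a v = L (a : A) v := rfl

/-- Right multiplication of `A^{co H}` on `A`. -/
abbrev coinvMulRight (k H A : Type*) [CommRing k] [Ring H] [HopfAlgebra k H] [Ring A] [Algebra k A]
    [ComoduleAlgebra k H A] : coinv k H A → Module.End k A :=
  fun s => LinearMap.mulRight k (s : A)

theorem canMod_balanced (L : A →ₐ[k] Module.End k V) (s : coinv k H A) (a : A) (v : V) :
    (diagAct H L).toLinearMap.compl₂ ((TensorProduct.mk k V H).flip 1) (coinvMulRight k H A s a) v =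
      (diagAct H L).toLinearMap.compl₂ ((TensorProduct.mk k V H).flip 1) a (coinvAct H L s v) := by
  simp [diagAct_coinv]

/-- The map `A ⊗_{A^{co H}} V → V ⊗ H`, `a ⊗ v ↦ a₀ v ⊗ a₁`, for a left `A`-module `V`. -/
def canMod (H : Type*) [Ring H] [HopfAlgebra k H] [ComoduleAlgebra k H A]
    (L : A →ₐ[k] Module.End k V) :
    BalTensor k (coinvMulRight k H A) (coinvAct H L) →ₗ[k] V ⊗[k] H :=
  BalTensor.lift ((diagAct H L).toLinearMap.compl₂ ((TensorProduct.mk k V H).flip 1))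
    (canMod_balanced L)

@[simp]
theorem canMod_tmul (L : A →ₐ[k] Module.End k V) (a : A) (v : V) :
    canMod H L (BalTensor.tmul _ _ a v) = diagAct H L a (v ⊗ₜ 1) := by
  rw [canMod, BalTensor.lift_tmul]
  rfl

theorem canMap_tmul (a b : A) :
    canMap k H A (BalTensor.tmul _ _ a b) = coact k H A a * b ⊗ₜ 1 := by
  simp [canMap, BalTensor.tmul]

/-- If the canonical map of `A` is bijective, so is `A ⊗_{A^{co H}} V → V ⊗ H` for every left
`A`-module `V`: it is obtained from the canonical map by applying `- ⊗_A V`. -/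
theorem canMod_bijective (hA : Function.Bijective (canMap k H A)) (L : A →ₐ[k] Module.End k V) :
    Function.Bijective (canMod H L) := by
  let can := LinearEquiv.ofBijective (canMap k H A) hA
  have rm_balanced (a : A) (s : coinv k H A) (b : A) :
      LinearMap.mulRight k a (LinearMap.mulLeft k (s : A) b) =
        LinearMap.mulLeft k (s : A) (LinearMap.mulRight k a b) := by simp [mul_assoc]
  -- right multiplication by `a` on the second factor of `A ⊗_{A^{co H}} A`
  let rm (a : A) : BalTensor k (coinvMulRight k H A)
      (fun s : coinv k H A => LinearMap.mulLeft k (s : A)) →ₗ[k]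
      BalTensor k (coinvMulRight k H A) (fun s : coinv k H A => LinearMap.mulLeft k (s : A)) :=
    BalTensor.lmap (coinvMulRight k H A) (LinearMap.mulRight k a) (rm_balanced a)
  have rm_tmul (a b c : A) : rm a (BalTensor.tmul _ _ b c) = BalTensor.tmul _ _ b (c * a) :=
    BalTensor.lmap_tmul _ _ _ _ _
  have can_rm (a : A) (z) : can (rm a z) = can z * a ⊗ₜ 1 := by
    induction z using BalTensor.induction with
    | zero => simp
    | add x y hx hy => simp [hx, hy, add_mul]
    | tmul b c => simp [can, rm_tmul, canMap_tmul, mul_assoc]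
  have q_balanced (v : V) (s : coinv k H A) (b : A) :
      L.toLinearMap.flip v (LinearMap.mulLeft k (s : A) b) =
        coinvAct H L s (L.toLinearMap.flip v b) := by simp
  -- `a ⊗ b ↦ a ⊗ b v`
  let q (v : V) : BalTensor k (coinvMulRight k H A)
      (fun s : coinv k H A => LinearMap.mulLeft k (s : A)) →ₗ[k]
      BalTensor k (coinvMulRight k H A) (coinvAct H L) :=
    BalTensor.lmap _ (L.toLinearMap.flip v) (q_balanced v)
  have q_tmul (v : V) (b c : A) : q v (BalTensor.tmul _ _ b c) = BalTensor.tmul _ _ b (L c v) :=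
    BalTensor.lmap_tmul _ _ _ _ _
  have q_rm (a : A) (v : V) (z) : q (L a v) z = q v (rm a z) := by
    induction z using BalTensor.induction with
    | zero => simp
    | add x y hx hy => simp [hx, hy]
    | tmul b c => simp [q_tmul, rm_tmul]
  have q_add (v w : V) (z) : q (v + w) z = q v z + q w z := by
    induction z using BalTensor.induction with
    | zero => simp
    | add x y hx hy => simp only [map_add, hx, hy]; abel
    | tmul b c => simp only [q_tmul, map_add, BalTensor.tmul_add]
  have q_smul (r : k) (v : V) (z) : q (r • v) z = r • q v z := by
    induction z using BalTensor.induction with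
    | zero => simp
    | add x y hx hy => simp only [map_add, hx, hy, smul_add]
    | tmul b c => simp only [q_tmul, map_smul, BalTensor.tmul_smul]
  have can_q (v : V) (z) : canMod H L (q v z) =
      (L.toLinearMap.flip v).rTensor H (can z) := by
    induction z using BalTensor.induction with
    | zero => simp
    | add x y hx hy => simp only [map_add, hx, hy]
    | tmul b c =>
      simp only [q_tmul, can, canMod_tmul, LinearEquiv.ofBijective_apply,
        canMap_tmul, diagAct_apply]
      induction coact k H A b with
      | zero => simp
      | add x y hx hy => simp [hx, hy, add_mul]
      | tmul x y => simp
  let inv : V ⊗[k] H →ₗ[k] BalTensor k (coinvMulRight k H A) (coinvAct H L) :=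
    TensorProduct.lift (LinearMap.mk₂ k (fun v h => q v (can.symm (1 ⊗ₜ h)))
      (fun _ _ _ => q_add _ _ _) (fun _ _ _ => q_smul _ _ _)
      (fun _ _ _ => by simp [TensorProduct.tmul_add]) (fun _ _ _ => by simp))
  have hl (z) : inv (canMod H L z) = z := by
    induction z using BalTensor.induction with
    | zero => simp
    | add x y hx hy => simp only [map_add, hx, hy]
    | tmul a v =>
      have key (p : A ⊗[k] H) : inv (actH H L p (v ⊗ₜ 1)) = q v (can.symm p) := by
        induction p with
        | zero => simp
        | add x y hx hy => simp only [map_add, LinearMap.add_apply, hx, hy]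
        | tmul b h =>
          have : can.symm (b ⊗ₜ h) = rm b (can.symm (1 ⊗ₜ h)) := by
            rw [LinearEquiv.symm_apply_eq, can_rm]
            simp
          simp [inv, this, q_rm]
      rw [canMod_tmul, diagAct_apply, key]
      have : can.symm (coact k H A a) = BalTensor.tmul _ _ a 1 := by
        rw [LinearEquiv.symm_apply_eq]
        simp [can, canMap_tmul, ← Algebra.TensorProduct.one_def]
      simp [this, q_tmul]
  have hr (z) : canMod H L (inv z) = z := by
    induction z with
    | zero => simp
    | add x y hx hy => simp only [map_add, hx, hy]
    | tmul v h => simp [inv, can_q]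
  exact ⟨Function.LeftInverse.injective hl, Function.RightInverse.surjective hr⟩

/-- Coassociativity of the coaction of `A`, read on the diagonal actions. -/
theorem lTensor_comul_diagAct (L : A →ₐ[k] Module.End k V) (a : A) (z : V ⊗[k] H) :
    (Coalgebra.comul (R := k) (A := H)).lTensor V (diagAct H L a z) =
      TensorProduct.assoc k V H H (diagAct H (diagAct H L) a ((TensorProduct.assoc k V H H).symm
        ((Coalgebra.comul (R := k) (A := H)).lTensor V z))) := by
  induction z with
  | zero => simp
  | add x y hx hy => simp only [map_add, hx, hy]
  | tmul v g =>
    -- `b ⊗ w ↦ b v ⊗ w w'`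
    let Φ (w' : H ⊗[k] H) : A ⊗[k] (H ⊗[k] H) →ₗ[k] V ⊗[k] (H ⊗[k] H) :=
      TensorProduct.map (L.toLinearMap.flip v) (LinearMap.mulRight k w')
    have h1 (p : A ⊗[k] H) : (Coalgebra.comul (R := k) (A := H)).lTensor V
        (actH H L p (v ⊗ₜ g)) = Φ (Coalgebra.comul g)
          ((Coalgebra.comul (R := k) (A := H)).lTensor A p) := by
      induction p with
      | zero => simp
      | add p q hp hq => simp only [map_add, LinearMap.add_apply, hp, hq]
      | tmul b h => simp [Φ]
    have h2 (p : A ⊗[k] H) (w : H ⊗[k] H) :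
        Φ w (TensorProduct.assoc k A H H ((coact k H A).toLinearMap.rTensor H p)) =
        TensorProduct.assoc k V H H (actH H (diagAct H L) p
          ((TensorProduct.assoc k V H H).symm (v ⊗ₜ w))) := by
      induction p with
      | zero => simp
      | add p q hp hq => simp only [map_add, LinearMap.add_apply, hp, hq]
      | tmul b h =>
        induction w with
        | zero => simp [Φ]
        | add w w' hw hw' =>
          simp only [TensorProduct.tmul_add, map_add] at *
          rw [← hw, ← hw']
          simp only [Φ, TensorProduct.map_add_right, LinearMap.add_apply,
            show LinearMap.mulRight k (w + w') = LinearMap.mulRight k w + LinearMap.mulRight k w' by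
              ext; simp [mul_add]]
        | tmul g₁ g₂ =>
          simp only [LinearMap.rTensor_tmul, AlgHom.toLinearMap_apply, diagAct_apply,
            TensorProduct.assoc_symm_tmul, actH_tmul]
          induction coact k H A b with
          | zero => simp
          | add p q hp hq => simp only [map_add, TensorProduct.add_tmul, LinearMap.add_apply, hp, hq]
          | tmul b h => simp [Φ]
    rw [diagAct_apply, diagAct_apply, h1, ← ComoduleAlgebra.coassoc, h2, LinearMap.lTensor_tmul]

theorem rid_counit_diagAct (L : A →ₐ[k] Module.End k V) (a : A) (z : V ⊗[k] H) :
    TensorProduct.rid k V ((Coalgebra.counit (R := k) (A := H)).lTensor V (diagAct H L a z)) =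
      L a (TensorProduct.rid k V ((Coalgebra.counit (R := k) (A := H)).lTensor V z)) := by
  induction z with
  | zero => simp
  | add x y hx hy => simp only [map_add, hx, hy]
  | tmul v g =>
    have key (p : A ⊗[k] H) : TensorProduct.rid k V
        ((Coalgebra.counit (R := k) (A := H)).lTensor V (actH H L p (v ⊗ₜ g))) =
        Coalgebra.counit (R := k) g •
        L (TensorProduct.rid k A ((Coalgebra.counit (R := k) (A := H)).lTensor A p)) v := by
      induction p with
      | zero => simp
      | add x y hx hy => simp only [map_add, LinearMap.add_apply, hx, hy, smul_add]
      | tmul a h => simp [smul_smul, mul_comm]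
    rw [diagAct_apply, key, ComoduleAlgebra.counit]
    simp

/-- The coinvariants `{v | ρ v = v ⊗ 1}` of a map `ρ : V → V ⊗ H`. -/
def coinvSub (ρ : V →ₗ[k] V ⊗[k] H) : Submodule k V :=
  LinearMap.ker (ρ - (TensorProduct.mk k V H).flip 1)

theorem mem_coinvSub {ρ : V →ₗ[k] V ⊗[k] H} {v : V} : v ∈ coinvSub ρ ↔ ρ v = v ⊗ₜ 1 := by
  simp [coinvSub, sub_eq_zero]

end Structure

section StructureTheorem

variable {k H A V W : Type u} [CommRing k] [Ring H] [HopfAlgebra k H] [Ring A] [Algebra k A]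
  [ComoduleAlgebra k H A]
  [AddCommGroup V] [Module k V] [AddCommGroup W] [Module k W]

theorem coinvSub_stable {L : A →ₐ[k] Module.End k V} {ρ : V →ₗ[k] V ⊗[k] H}
    (hρ : ∀ a v, ρ (L a v) = diagAct H L a (ρ v)) (a : coinv k H A) (v : V) (hv : v ∈ coinvSub ρ) :
    coinvAct H L a v ∈ coinvSub ρ := by
  rw [mem_coinvSub] at *
  rw [coinvAct_apply, hρ, hv, diagAct_coinv]

/-- For a left relative Hopf module `V` over a Galois extension that is right flat, a left
`A`-linear map `θ : V → W`, and `v : V` such that `θ(v₀) ⊗ v₁ = 0`, the element `v` lies in the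
`A`-submodule generated by the coinvariants killed by `θ`. With `θ = 0` this is the surjectivity of
`A ⊗_{A^{co H}} V^{co H} → V`. The proof exhibits `A ⊗ (V^{co H} ∩ ker θ)` as the kernel of
`A ⊗ V → A ⊗ ((V ⊗ H) × W)` by flatness, and identifies this map by means of the canonical
isomorphisms `A ⊗ V ≃ V ⊗ H`. -/
theorem exists_coinv_preimage (hA : IsRightFaithfullyFlatGalois k H A)
    {L : A →ₐ[k] Module.End k V} {L' : A →ₐ[k] Module.End k W} {ρ : V →ₗ[k] V ⊗[k] H}
    (hcoassoc : ∀ v, TensorProduct.assoc k V H H (ρ.rTensor H (ρ v)) =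
      (Coalgebra.comul (R := k) (A := H)).lTensor V (ρ v))
    (hcounit : ∀ v, TensorProduct.rid k V ((Coalgebra.counit (R := k) (A := H)).lTensor V (ρ v)) = v)
    (hρ : ∀ a v, ρ (L a v) = diagAct H L a (ρ v))
    {θ : V →ₗ[k] W} (hθ : ∀ a v, θ (L a v) = L' a (θ v))
    {v : V} (hv : θ.rTensor H (ρ v) = 0) :
    v ∈ Submodule.span k {x | ∃ a, ∃ c ∈ coinvSub ρ, θ c = 0 ∧ x = L a c} := by
  let C : Submodule k V := coinvSub ρ ⊓ LinearMap.ker θ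
  let R := coinv k H A
  have hC (r : R) (v) (hv : v ∈ C) : coinvAct H L r v ∈ C :=
    ⟨coinvSub_stable hρ r _ hv.1, by
      have h0 : θ v = 0 := hv.2
      change θ (L r v) = 0
      rw [hθ, h0, map_zero]⟩
  let LW : A →ₐ[k] Module.End k ((V ⊗[k] H) × W) :=
    (LinearMap.prodMapAlgHom k (V ⊗[k] H) W).comp ((diagAct H L).prod L')
  let g : V →ₗ[k] (V ⊗[k] H) × W := (ρ - (TensorProduct.mk k V H).flip 1).prod θ
  have hg (r : R) (v : V) : g (coinvAct H L r v) = coinvAct H LW r (g v) := by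
    simp [g, LW, hρ, hθ, diagAct_coinv]
  have hs (r : R) (v : C) : C.subtype (restrictAct (coinvAct H L) C hC r v) =
      coinvAct H L r (C.subtype v) := rfl
  have hex := hA.faithfullyFlat.exact_lmap (l := restrictAct (coinvAct H L) C hC)
    (l' := coinvAct H L) (l'' := coinvAct H LW) C.subtype g hs hg (by
      intro v
      simp [g, C, mem_coinvSub, Prod.ext_iff, sub_eq_zero])
  obtain ⟨ξ, hξ⟩ := (canMod_bijective hA.can_bijective L).2 (ρ v)
  -- the map `A ⊗ V → A ⊗ ((V ⊗ H) × W)`, read on `V ⊗ H`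
  let ψ : V ⊗[k] H →ₗ[k] ((V ⊗[k] H) × W) ⊗[k] H :=
    ((LinearMap.inl k (V ⊗[k] H) W ∘ₗ ρ) + LinearMap.inr k (V ⊗[k] H) W ∘ₗ θ).rTensor H -
      (LinearMap.inl k (V ⊗[k] H) W).rTensor H ∘ₗ (TensorProduct.assoc k V H H).symm.toLinearMap ∘ₗ
        (Coalgebra.comul (R := k) (A := H)).lTensor V
  have hψ (z) : canMod H LW (BalTensor.lmap _ g hg z) = ψ (canMod H L z) := by
    induction z using BalTensor.induction with
    | zero => simp
    | add x y hx hy => simp only [map_add, hx, hy]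
    | tmul a v =>
      have h1 (p : A ⊗[k] H) (x : V ⊗[k] H) (w : W) : actH H LW p ((x, w) ⊗ₜ 1) =
          (LinearMap.inl k (V ⊗[k] H) W).rTensor H (actH H (diagAct H L) p (x ⊗ₜ 1)) +
          (LinearMap.inr k (V ⊗[k] H) W).rTensor H (actH H L' p (w ⊗ₜ 1)) := by
        induction p with
        | zero => simp
        | add p q hp hq => simp only [map_add, LinearMap.add_apply, hp, hq]; abel
        | tmul b h => simp [LW, ← TensorProduct.add_tmul]
      have h4 (p : A ⊗[k] H) : ρ.rTensor H (actH H L p (v ⊗ₜ 1)) =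
          actH H (diagAct H L) p (ρ v ⊗ₜ 1) := by
        rw [rTensor_actH L (diagAct H L) ρ hρ]; simp
      have h5 (p : A ⊗[k] H) : θ.rTensor H (actH H L p (v ⊗ₜ 1)) = actH H L' p (θ v ⊗ₜ 1) := by
        rw [rTensor_actH L L' θ hθ]; simp
      have h6 : actH H (diagAct H L) (coact k H A a) ((v ⊗ₜ 1) ⊗ₜ 1) =
          (TensorProduct.assoc k V H H).symm ((Coalgebra.comul (R := k) (A := H)).lTensor V
            (actH H L (coact k H A a) (v ⊗ₜ 1))) := by
        have h := lTensor_comul_diagAct L a (v ⊗ₜ[k] (1 : H))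
        simp only [LinearMap.lTensor_tmul, Bialgebra.comul_one, Algebra.TensorProduct.one_def,
          TensorProduct.assoc_symm_tmul] at h
        rw [← diagAct_apply, ← diagAct_apply, h, LinearEquiv.symm_apply_apply]
      rw [BalTensor.lmap_tmul, canMod_tmul, canMod_tmul, diagAct_apply]
      change actH H LW _ ((ρ v - v ⊗ₜ 1, θ v) ⊗ₜ 1) = _
      rw [h1]
      simp only [ψ, LinearMap.rTensor_add, LinearMap.rTensor_comp, LinearMap.sub_apply,
        LinearMap.add_apply, LinearMap.comp_apply, diagAct_apply, h4, h5,
        LinearEquiv.coe_coe, TensorProduct.sub_tmul, map_sub]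
      rw [← h6]
      abel
  have hz : BalTensor.lmap _ g hg ξ = 0 := by
    apply (canMod_bijective hA.can_bijective LW).1
    rw [hψ, hξ, map_zero]
    have h7 : (TensorProduct.assoc k V H H).symm
        ((Coalgebra.comul (R := k) (A := H)).lTensor V (ρ v)) = ρ.rTensor H (ρ v) := by
      rw [LinearEquiv.symm_apply_eq, hcoassoc]
    simp [ψ, LinearMap.rTensor_add, LinearMap.rTensor_comp, hv, h7]
  obtain ⟨ζ, hζ⟩ := (hex ξ).1 hz
  rw [← hcounit v, ← hξ, ← hζ]
  clear hζ hξ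
  induction ζ using BalTensor.induction with
  | zero => simp
  | add x y hx hy => simpa only [map_add] using add_mem hx hy
  | tmul a c =>
    rw [BalTensor.lmap_tmul, canMod_tmul, rid_counit_diagAct]
    refine Submodule.subset_span ⟨a, c, c.2.1, c.2.2, ?_⟩
    simp

theorem coinvMul_balanced {L : A →ₐ[k] Module.End k V} {ρ : V →ₗ[k] V ⊗[k] H}
    (hρ : ∀ a v, ρ (L a v) = diagAct H L a (ρ v)) (s : coinv k H A) (a : A) (v : coinvSub ρ) :
    L.toLinearMap.compl₂ (coinvSub ρ).subtype (coinvMulRight k H A s a) v =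
      L.toLinearMap.compl₂ (coinvSub ρ).subtype a
        (restrictAct (coinvAct H L) (coinvSub ρ) (coinvSub_stable hρ) s v) := by
  simp

/-- The multiplication map `A ⊗_{A^{co H}} V^{co H} → V` of a left relative Hopf module. -/
def coinvMul {L : A →ₐ[k] Module.End k V} {ρ : V →ₗ[k] V ⊗[k] H}
    (hρ : ∀ a v, ρ (L a v) = diagAct H L a (ρ v)) :
    BalTensor k (coinvMulRight k H A)
      (restrictAct (coinvAct H L) (coinvSub ρ) (coinvSub_stable hρ)) →ₗ[k] V :=
  BalTensor.lift (L.toLinearMap.compl₂ (coinvSub ρ).subtype) (coinvMul_balanced hρ)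

@[simp]
theorem coinvMul_tmul {L : A →ₐ[k] Module.End k V} {ρ : V →ₗ[k] V ⊗[k] H}
    (hρ : ∀ a v, ρ (L a v) = diagAct H L a (ρ v)) (a : A) (v : coinvSub ρ) :
    coinvMul hρ (BalTensor.tmul _ _ a v) = L a v := by
  simp [coinvMul]

/-- The structure theorem for left relative Hopf modules: `A ⊗_{A^{co H}} V^{co H} ≃ V`. The
composite of the multiplication map with `ρ` is the restriction of the isomorphism
`A ⊗_{A^{co H}} V ≃ V ⊗ H`, and is injective by flatness. -/
theorem coinvMul_bijective (hA : IsRightFaithfullyFlatGalois k H A)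
    {L : A →ₐ[k] Module.End k V} {ρ : V →ₗ[k] V ⊗[k] H}
    (hcoassoc : ∀ v, TensorProduct.assoc k V H H (ρ.rTensor H (ρ v)) =
      (Coalgebra.comul (R := k) (A := H)).lTensor V (ρ v))
    (hcounit : ∀ v, TensorProduct.rid k V ((Coalgebra.counit (R := k) (A := H)).lTensor V (ρ v)) = v)
    (hρ : ∀ a v, ρ (L a v) = diagAct H L a (ρ v)) : Function.Bijective (coinvMul hρ) := by
  have hs (r : coinv k H A) (v : coinvSub ρ) : (coinvSub ρ).subtype
      (restrictAct (coinvAct H L) (coinvSub ρ) (coinvSub_stable hρ) r v) =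
      coinvAct H L r ((coinvSub ρ).subtype v) := rfl
  constructor
  · refine (injective_iff_map_eq_zero _).2 fun z hz => ?_
    apply hA.faithfullyFlat.lmap_injective (l' := coinvAct H L)
      (coinvSub ρ).subtype hs (Submodule.injective_subtype _)
    apply (canMod_bijective hA.can_bijective L).1
    rw [map_zero, map_zero]
    have h (z) : canMod H L (BalTensor.lmap _ (coinvSub ρ).subtype hs z) =
        ρ (coinvMul hρ z) := by
      induction z using BalTensor.induction with
      | zero => simp
      | add x y hx hy => simp only [map_add, hx, hy]
      | tmul a c =>
        rw [BalTensor.lmap_tmul, canMod_tmul, coinvMul_tmul, hρ, mem_coinvSub.1 c.2]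
        rfl
    rw [h, hz, map_zero]
  · intro v
    have := exists_coinv_preimage (L' := L) (θ := (0 : V →ₗ[k] V)) (v := v) hA hcoassoc hcounit hρ
      (by simp) (by simp)
    have hle : Submodule.span k {x | ∃ a, ∃ c ∈ coinvSub ρ, (0 : V →ₗ[k] V) c = 0 ∧ x = L a c} ≤
        LinearMap.range (coinvMul hρ) := by
      refine Submodule.span_le.2 ?_
      rintro _ ⟨a, c, hc, -, rfl⟩
      exact ⟨BalTensor.tmul _ _ a ⟨c, hc⟩, by simp⟩
    exact hle this

end StructureTheorem

/-! ### Diagonal actions of `A ⊗ Bᵒᵖ` -/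

section BiDiag

variable {k H A B V W : Type*} [CommRing k] [Ring H] [HopfAlgebra k H] [Ring A] [Algebra k A]
  [Ring B] [Algebra k B]
  [AddCommGroup V] [Module k V] [AddCommGroup W] [Module k W]

/-- The right action `(v ⊗ g)(b ⊗ h) = v b ⊗ g h` of `B ⊗ H` on `V ⊗ H`, where `L` is a right
action of `B` on `V`. -/
def ractH (H : Type*) [Ring H] [HopfAlgebra k H] (L : Bᵐᵒᵖ →ₐ[k] Module.End k V) :
    (B ⊗[k] H)ᵐᵒᵖ →ₐ[k] Module.End k (V ⊗[k] H) :=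
  ((Module.endTensorEndAlgHom (R := k) (S := k) (A := k)).comp
    (Algebra.TensorProduct.map L (Algebra.lsmul k k H : Hᵐᵒᵖ →ₐ[k] Module.End k H))).comp
    ((Algebra.TensorProduct.opAlgEquiv k k B H).symm : (B ⊗[k] H)ᵐᵒᵖ →ₐ[k] Bᵐᵒᵖ ⊗[k] Hᵐᵒᵖ)

@[simp]
theorem ractH_tmul (L : Bᵐᵒᵖ →ₐ[k] Module.End k V) (b : B) (h : H) (v : V) (g : H) :
    ractH H L (MulOpposite.op (b ⊗ₜ h)) (v ⊗ₜ g) = L (MulOpposite.op b) v ⊗ₜ (g * h) := by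
  simp [ractH, Module.endTensorEndAlgHom_apply]

theorem rTensor_ractH (L : Bᵐᵒᵖ →ₐ[k] Module.End k V) (L' : Bᵐᵒᵖ →ₐ[k] Module.End k W)
    (θ : V →ₗ[k] W) (hθ : ∀ b v, θ (L b v) = L' b (θ v)) (q : B ⊗[k] H) (z : V ⊗[k] H) :
    θ.rTensor H (ractH H L (MulOpposite.op q) z) =
      ractH H L' (MulOpposite.op q) (θ.rTensor H z) := by
  induction q with
  | zero => simp
  | add p q hp hq => simp [hp, hq]
  | tmul a h =>
    induction z with
    | zero => simp
    | add p q hp hq => simp [hp, hq]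
    | tmul v g => simp [hθ]

theorem actH_ractH_comm (L : A →ₐ[k] Module.End k V) (R : Bᵐᵒᵖ →ₐ[k] Module.End k V)
    (h : ∀ a b, Commute (L a) (R b)) (p : A ⊗[k] H) (q : (B ⊗[k] H)ᵐᵒᵖ) :
    Commute (actH H L p) (ractH H R q) := by
  induction p with
  | zero => simp
  | add p p' hp hp' => simpa only [map_add] using hp.add_left hp'
  | tmul a g =>
    induction q with | h q =>
    induction q with
    | zero => simp
    | add q q' hq hq' => simpa only [map_add, MulOpposite.op_add] using hq.add_right hq'
    | tmul b g' =>
      refine TensorProduct.ext' fun v g'' => ?_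
      have := LinearMap.congr_fun (h a (MulOpposite.op b)) v
      simp only [Module.End.mul_apply] at this
      simp [this, mul_assoc]

variable [ComoduleAlgebra k H A] [ComoduleAlgebra k H B]

/-- The diagonal right action `(v ⊗ g) b = v b₀ ⊗ g b₁` of `B` on `V ⊗ H`. -/
def rdiagAct (H : Type*) [Ring H] [HopfAlgebra k H] [ComoduleAlgebra k H B]
    (L : Bᵐᵒᵖ →ₐ[k] Module.End k V) : Bᵐᵒᵖ →ₐ[k] Module.End k (V ⊗[k] H) :=
  (ractH H L).comp (coact k H B).op

theorem rdiagAct_op (L : Bᵐᵒᵖ →ₐ[k] Module.End k V) (b : B) :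
    rdiagAct H L (MulOpposite.op b) = ractH H L (MulOpposite.op (coact k H B b)) := rfl

theorem lTensor_comul_rdiagAct (L : Bᵐᵒᵖ →ₐ[k] Module.End k V) (b : Bᵐᵒᵖ) (z : V ⊗[k] H) :
    (Coalgebra.comul (R := k) (A := H)).lTensor V (rdiagAct H L b z) =
      TensorProduct.assoc k V H H (rdiagAct H (rdiagAct H L) b ((TensorProduct.assoc k V H H).symm
        ((Coalgebra.comul (R := k) (A := H)).lTensor V z))) := by
  induction b with | h b =>
  induction z with
  | zero => simp
  | add x y hx hy => simp only [map_add, hx, hy]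
  | tmul v g =>
    -- `c ⊗ w ↦ v c ⊗ w' w`
    let Φ (w' : H ⊗[k] H) : B ⊗[k] (H ⊗[k] H) →ₗ[k] V ⊗[k] (H ⊗[k] H) :=
      TensorProduct.map (L.toLinearMap.flip v ∘ₗ (MulOpposite.opLinearEquiv k).toLinearMap)
        (LinearMap.mulLeft k w')
    have h1 (p : B ⊗[k] H) : (Coalgebra.comul (R := k) (A := H)).lTensor V
        (ractH H L (MulOpposite.op p) (v ⊗ₜ g)) = Φ (Coalgebra.comul g)
          ((Coalgebra.comul (R := k) (A := H)).lTensor B p) := by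
      induction p with
      | zero => simp
      | add p q hp hq => simp only [map_add, MulOpposite.op_add, LinearMap.add_apply, hp, hq]
      | tmul b h => simp [Φ]
    have h2 (p : B ⊗[k] H) (w : H ⊗[k] H) :
        Φ w (TensorProduct.assoc k B H H ((coact k H B).toLinearMap.rTensor H p)) =
        TensorProduct.assoc k V H H (ractH H (rdiagAct H L) (MulOpposite.op p)
          ((TensorProduct.assoc k V H H).symm (v ⊗ₜ w))) := by
      induction p with
      | zero => simp
      | add p q hp hq => simp only [map_add, MulOpposite.op_add, LinearMap.add_apply, hp, hq]
      | tmul b h =>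
        induction w with
        | zero => simp [Φ]
        | add w w' hw hw' =>
          simp only [TensorProduct.tmul_add, map_add] at *
          rw [← hw, ← hw']
          simp only [Φ, TensorProduct.map_add_right, LinearMap.add_apply,
            show LinearMap.mulLeft k (w + w') = LinearMap.mulLeft k w + LinearMap.mulLeft k w' by
              ext; simp [add_mul]]
        | tmul g₁ g₂ =>
          simp only [LinearMap.rTensor_tmul, AlgHom.toLinearMap_apply, rdiagAct_op,
            TensorProduct.assoc_symm_tmul, ractH_tmul]
          induction coact k H B b with
          | zero => simp
          | add p q hp hq =>
            simp only [map_add, MulOpposite.op_add, TensorProduct.add_tmul, LinearMap.add_apply,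
              hp, hq]
          | tmul b h => simp [Φ]
    rw [rdiagAct_op, rdiagAct_op, h1, ← ComoduleAlgebra.coassoc, h2, LinearMap.lTensor_tmul]

theorem rid_counit_rdiagAct (L : Bᵐᵒᵖ →ₐ[k] Module.End k V) (b : Bᵐᵒᵖ) (z : V ⊗[k] H) :
    TensorProduct.rid k V ((Coalgebra.counit (R := k) (A := H)).lTensor V (rdiagAct H L b z)) =
      L b (TensorProduct.rid k V ((Coalgebra.counit (R := k) (A := H)).lTensor V z)) := by
  induction b with | h b =>
  induction z with
  | zero => simp
  | add x y hx hy => simp only [map_add, hx, hy]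
  | tmul v g =>
    have key (p : B ⊗[k] H) : TensorProduct.rid k V
        ((Coalgebra.counit (R := k) (A := H)).lTensor V (ractH H L (MulOpposite.op p) (v ⊗ₜ g))) =
        Coalgebra.counit (R := k) g • L (MulOpposite.op
          (TensorProduct.rid k B ((Coalgebra.counit (R := k) (A := H)).lTensor B p))) v := by
      induction p with
      | zero => simp
      | add x y hx hy => simp only [map_add, MulOpposite.op_add, LinearMap.add_apply, hx, hy,
          smul_add]
      | tmul a h => simp [smul_smul]
    rw [rdiagAct_op, key, ComoduleAlgebra.counit]
    simp

/-- The left action of `A` underlying an action of `A ⊗ Bᵒᵖ`. -/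
def leftPart (L : A ⊗[k] Bᵐᵒᵖ →ₐ[k] Module.End k V) : A →ₐ[k] Module.End k V :=
  L.comp Algebra.TensorProduct.includeLeft

/-- The right action of `B` underlying an action of `A ⊗ Bᵒᵖ`. -/
def rightPart (L : A ⊗[k] Bᵐᵒᵖ →ₐ[k] Module.End k V) : Bᵐᵒᵖ →ₐ[k] Module.End k V :=
  L.comp Algebra.TensorProduct.includeRight

theorem leftPart_apply (L : A ⊗[k] Bᵐᵒᵖ →ₐ[k] Module.End k V) (a : A) :
    leftPart L a = L (a ⊗ₜ 1) := rfl

theorem rightPart_apply (L : A ⊗[k] Bᵐᵒᵖ →ₐ[k] Module.End k V) (b : Bᵐᵒᵖ) :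
    rightPart L b = L (1 ⊗ₜ b) := rfl

theorem apply_tmul_eq (L : A ⊗[k] Bᵐᵒᵖ →ₐ[k] Module.End k V) (a : A) (b : Bᵐᵒᵖ) (v : V) :
    L (a ⊗ₜ b) v = leftPart L a (rightPart L b v) := by
  rw [leftPart_apply, rightPart_apply, ← Module.End.mul_apply, ← map_mul]
  simp

theorem leftPart_rightPart_commute (L : A ⊗[k] Bᵐᵒᵖ →ₐ[k] Module.End k V) (a : A) (b : Bᵐᵒᵖ) :
    Commute (leftPart L a) (rightPart L b) := by
  simp [Commute, SemiconjBy, leftPart_apply, rightPart_apply, ← map_mul]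

/-- The diagonal action `(a ⊗ b)(v ⊗ g) = a₀ v b₀ ⊗ a₁ g b₁` of `A ⊗ Bᵒᵖ` on `V ⊗ H`. A map
`ρ : V → V ⊗ H` satisfies `ρ(a m b) = a₀ m₀ b₀ ⊗ a₁ m₁ b₁` if and only if it is linear for this
action. -/
def biDiag (H : Type*) [Ring H] [HopfAlgebra k H] [ComoduleAlgebra k H A] [ComoduleAlgebra k H B]
    (L : A ⊗[k] Bᵐᵒᵖ →ₐ[k] Module.End k V) : A ⊗[k] Bᵐᵒᵖ →ₐ[k] Module.End k (V ⊗[k] H) :=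
  Algebra.TensorProduct.lift (diagAct H (leftPart L)) (rdiagAct H (rightPart L))
    (fun _ _ => actH_ractH_comm _ _ (leftPart_rightPart_commute L) _ _)

theorem leftPart_biDiag (L : A ⊗[k] Bᵐᵒᵖ →ₐ[k] Module.End k V) :
    leftPart (biDiag H L) = diagAct H (leftPart L) :=
  Algebra.TensorProduct.lift_comp_includeLeft _ _ _

theorem rightPart_biDiag (L : A ⊗[k] Bᵐᵒᵖ →ₐ[k] Module.End k V) :
    rightPart (biDiag H L) = rdiagAct H (rightPart L) :=
  Algebra.TensorProduct.lift_comp_includeRight' _ _ _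

theorem biDiag_tmul (L : A ⊗[k] Bᵐᵒᵖ →ₐ[k] Module.End k V) (a : A) (b : Bᵐᵒᵖ) (z : V ⊗[k] H) :
    biDiag H L (a ⊗ₜ b) z = diagAct H (leftPart L) a (rdiagAct H (rightPart L) b z) := by
  rw [apply_tmul_eq, leftPart_biDiag, rightPart_biDiag]

theorem rTensor_biDiag (L : A ⊗[k] Bᵐᵒᵖ →ₐ[k] Module.End k V)
    (L' : A ⊗[k] Bᵐᵒᵖ →ₐ[k] Module.End k W) (θ : V →ₗ[k] W)
    (hθ : ∀ x v, θ (L x v) = L' x (θ v)) (x : A ⊗[k] Bᵐᵒᵖ) (z : V ⊗[k] H) :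
    θ.rTensor H (biDiag H L x z) = biDiag H L' x (θ.rTensor H z) := by
  induction x with
  | zero => simp
  | add p q hp hq => simp [hp, hq]
  | tmul a b =>
    induction b with | h b =>
    rw [biDiag_tmul, biDiag_tmul, diagAct_apply, diagAct_apply, rdiagAct_op, rdiagAct_op,
      rTensor_actH _ (leftPart L') θ (fun _ _ => hθ _ _),
      rTensor_ractH _ (rightPart L') θ (fun _ _ => hθ _ _)]

theorem lTensor_comul_biDiag (L : A ⊗[k] Bᵐᵒᵖ →ₐ[k] Module.End k V) (x : A ⊗[k] Bᵐᵒᵖ)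
    (z : V ⊗[k] H) :
    (Coalgebra.comul (R := k) (A := H)).lTensor V (biDiag H L x z) =
      TensorProduct.assoc k V H H (biDiag H (biDiag H L) x ((TensorProduct.assoc k V H H).symm
        ((Coalgebra.comul (R := k) (A := H)).lTensor V z))) := by
  induction x with
  | zero => simp
  | add p q hp hq => simp only [map_add, LinearMap.add_apply, hp, hq]
  | tmul a b =>
    rw [biDiag_tmul, biDiag_tmul, leftPart_biDiag, rightPart_biDiag, lTensor_comul_diagAct,
      lTensor_comul_rdiagAct, LinearEquiv.symm_apply_apply]

theorem rid_counit_biDiag (L : A ⊗[k] Bᵐᵒᵖ →ₐ[k] Module.End k V) (x : A ⊗[k] Bᵐᵒᵖ)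
    (z : V ⊗[k] H) :
    TensorProduct.rid k V ((Coalgebra.counit (R := k) (A := H)).lTensor V (biDiag H L x z)) =
      L x (TensorProduct.rid k V ((Coalgebra.counit (R := k) (A := H)).lTensor V z)) := by
  induction x with
  | zero => simp
  | add p q hp hq => simp only [map_add, LinearMap.add_apply, hp, hq]
  | tmul a b =>
    rw [biDiag_tmul, rid_counit_diagAct, rid_counit_rdiagAct, apply_tmul_eq]

/-- A linear map `ρ : V → V ⊗ H` compatible with the action of `A ⊗ Bᵒᵖ` is coassociative on the
submodule generated by its coinvariants. -/
theorem coassoc_of_coinv {L : A ⊗[k] Bᵐᵒᵖ →ₐ[k] Module.End k V} {ρ : V →ₗ[k] V ⊗[k] H}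
    (hρ : ∀ x v, ρ (L x v) = biDiag H L x (ρ v)) {v : V} (hv : ρ v = v ⊗ₜ 1) (x : A ⊗[k] Bᵐᵒᵖ) :
    TensorProduct.assoc k V H H (ρ.rTensor H (ρ (L x v))) =
      (Coalgebra.comul (R := k) (A := H)).lTensor V (ρ (L x v)) := by
  rw [hρ, hv, rTensor_biDiag L (biDiag H L) ρ hρ, lTensor_comul_biDiag]
  simp [hv, Algebra.TensorProduct.one_def]

theorem counit_of_coinv {L : A ⊗[k] Bᵐᵒᵖ →ₐ[k] Module.End k V} {ρ : V →ₗ[k] V ⊗[k] H}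
    (hρ : ∀ x v, ρ (L x v) = biDiag H L x (ρ v)) {v : V} (hv : ρ v = v ⊗ₜ 1) (x : A ⊗[k] Bᵐᵒᵖ) :
    TensorProduct.rid k V ((Coalgebra.counit (R := k) (A := H)).lTensor V (ρ (L x v))) = L x v := by
  rw [hρ, hv, rid_counit_biDiag]
  simp

end BiDiag

/-! ### The cotensor product as coinvariants of `A ⊗ Bᵒᵖ` -/

section Cotensor

variable {k H A B : Type*} [CommRing k] [Ring H] [HopfAlgebra k H] [BijectiveAntipode k H]

theorem antipode_antipodeInv (h : H) :
    HopfAlgebra.antipode k (antipodeInv k H (MulOpposite.op h)) = h := by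
  have := (AlgEquiv.ofBijective (HopfAlgebra.antipodeAlgHomOp k H)
    (MulOpposite.op_bijective.comp BijectiveAntipode.bijective)).apply_symm_apply (MulOpposite.op h)
  exact MulOpposite.op_injective this

/-- `S⁻¹(h₂) h₁ = ε(h)`. -/
theorem antipodeInv_mul_comul (h : H) :
    TensorProduct.lift ((LinearMap.mul k H).flip.compl₂
      ((antipodeInv k H).toLinearMap ∘ₗ (MulOpposite.opLinearEquiv k).toLinearMap))
      (Coalgebra.comul (R := k) h) = algebraMap k H (Coalgebra.counit h) := by
  apply BijectiveAntipode.bijective (k := k) (H := H).1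
  have h1 (w : H ⊗[k] H) : HopfAlgebra.antipode k (TensorProduct.lift
      ((LinearMap.mul k H).flip.compl₂
      ((antipodeInv k H).toLinearMap ∘ₗ (MulOpposite.opLinearEquiv k).toLinearMap)) w) =
      LinearMap.mul' k H ((HopfAlgebra.antipode k).rTensor H w) := by
    induction w with
    | zero => simp
    | add x y hx hy => simp only [map_add, hx, hy]
    | tmul x y => simp [HopfAlgebra.antipode_mul_antidistrib, antipode_antipodeInv]
  rw [h1, HopfAlgebra.mul_antipode_rTensor_comul_apply, Algebra.algebraMap_eq_smul_one]
  simp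

/-- `h₂ S⁻¹(h₁) = ε(h)`. -/
theorem mul_antipodeInv_comul (h : H) :
    TensorProduct.lift ((LinearMap.mul k H).flip ∘ₗ
      ((antipodeInv k H).toLinearMap ∘ₗ (MulOpposite.opLinearEquiv k).toLinearMap))
      (Coalgebra.comul (R := k) h) = algebraMap k H (Coalgebra.counit h) := by
  apply BijectiveAntipode.bijective (k := k) (H := H).1
  have h1 (w : H ⊗[k] H) : HopfAlgebra.antipode k (TensorProduct.lift
      ((LinearMap.mul k H).flip ∘ₗ
      ((antipodeInv k H).toLinearMap ∘ₗ (MulOpposite.opLinearEquiv k).toLinearMap)) w) =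
      LinearMap.mul' k H ((HopfAlgebra.antipode k).lTensor H w) := by
    induction w with
    | zero => simp
    | add x y hx hy => simp only [map_add, hx, hy]
    | tmul x y => simp [HopfAlgebra.antipode_mul_antidistrib, antipode_antipodeInv]
  rw [h1, HopfAlgebra.mul_antipode_lTensor_comul_apply, Algebra.algebraMap_eq_smul_one]
  simp

variable [Ring A] [Algebra k A] [ComoduleAlgebra k H A] [Ring B] [Algebra k B]
  [ComoduleAlgebra k H B]

theorem opCoact_op (b : B) : opCoact k H B (MulOpposite.op b) =
    TensorProduct.map ((antipodeInv k H).toLinearMap ∘ₗ (MulOpposite.opLinearEquiv k).toLinearMap)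
      (MulOpposite.opLinearEquiv k).toLinearMap (TensorProduct.comm k B H (coact k H B b)) := by
  simp only [opCoact, AlgHom.comp_apply, AlgHom.op_apply_apply, MulOpposite.unop_op]
  induction coact k H B b with
  | zero => simp
  | add x y hx hy => simp only [map_add, MulOpposite.op_add, hx, hy]
  | tmul x y => simp

variable (k H B) in
/-- The map `H ⊗ Bᵒᵖ → Bᵒᵖ ⊗ H`, `h ⊗ b ↦ b₀ ⊗ h b₁`, which transforms the two sides of the
equation defining the cotensor product to the diagonal coaction and to `x ↦ x ⊗ 1`. -/
def cotensorTwist : H ⊗[k] Bᵐᵒᵖ →ₗ[k] Bᵐᵒᵖ ⊗[k] H :=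
  TensorProduct.lift (LinearMap.mk₂ k (fun h b =>
    TensorProduct.map (MulOpposite.opLinearEquiv k).toLinearMap (LinearMap.mulLeft k h)
      (coact k H B b.unop))
    (fun h h' b => by
      rw [show LinearMap.mulLeft k (h + h') = LinearMap.mulLeft k h + LinearMap.mulLeft k h' by
        ext; simp [add_mul], TensorProduct.map_add_right, LinearMap.add_apply])
    (fun c h b => by
      rw [show LinearMap.mulLeft k (c • h) = c • LinearMap.mulLeft k h by
        ext; simp, TensorProduct.map_smul_right, LinearMap.smul_apply])
    (by simp) (by simp))

omit [BijectiveAntipode k H] in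
theorem cotensorTwist_tmul (h : H) (b : B) : cotensorTwist k H B (h ⊗ₜ MulOpposite.op b) =
    TensorProduct.map (MulOpposite.opLinearEquiv k).toLinearMap (LinearMap.mulLeft k h)
      (coact k H B b) := by
  simp [cotensorTwist]

theorem cotensorTwist_opCoact (b : Bᵐᵒᵖ) :
    cotensorTwist k H B (opCoact k H B b) = b ⊗ₜ 1 := by
  induction b with | h b =>
  have h1 (p : B ⊗[k] H) : cotensorTwist k H B (TensorProduct.map
      ((antipodeInv k H).toLinearMap ∘ₗ (MulOpposite.opLinearEquiv k).toLinearMap)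
      (MulOpposite.opLinearEquiv k).toLinearMap (TensorProduct.comm k B H p)) =
      TensorProduct.map (MulOpposite.opLinearEquiv k).toLinearMap
        (TensorProduct.lift ((LinearMap.mul k H).flip.compl₂
        ((antipodeInv k H).toLinearMap ∘ₗ (MulOpposite.opLinearEquiv k).toLinearMap)))
        (TensorProduct.assoc k B H H ((coact k H B).toLinearMap.rTensor H p)) := by
    induction p with
    | zero => simp
    | add x y hx hy => simp only [map_add, hx, hy]
    | tmul b h =>
      simp only [TensorProduct.comm_tmul, TensorProduct.map_tmul, LinearMap.comp_apply,
        LinearEquiv.coe_coe, MulOpposite.coe_opLinearEquiv, cotensorTwist_tmul,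
        LinearMap.rTensor_tmul, AlgHom.toLinearMap_apply]
      induction coact k H B b with
      | zero => simp
      | add x y hx hy => simp only [map_add, TensorProduct.add_tmul, hx, hy]
      | tmul b h => simp
  have h2 (p : B ⊗[k] H) : TensorProduct.map (MulOpposite.opLinearEquiv k : B ≃ₗ[k] _).toLinearMap
        (TensorProduct.lift ((LinearMap.mul k H).flip.compl₂
        ((antipodeInv k H).toLinearMap ∘ₗ (MulOpposite.opLinearEquiv k).toLinearMap)))
        ((Coalgebra.comul (R := k) (A := H)).lTensor B p) =
      MulOpposite.op (TensorProduct.rid k B ((Coalgebra.counit (R := k) (A := H)).lTensor B p)) ⊗ₜ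
        1 := by
    induction p with
    | zero => simp
    | add x y hx hy => simp only [map_add, MulOpposite.op_add, TensorProduct.add_tmul, hx, hy]
    | tmul b h =>
      rw [LinearMap.lTensor_tmul, TensorProduct.map_tmul, antipodeInv_mul_comul]
      simp [Algebra.algebraMap_eq_smul_one, TensorProduct.smul_tmul]
  rw [opCoact_op, h1, ComoduleAlgebra.coassoc, h2, ComoduleAlgebra.counit]

variable (k H B) in
/-- The inverse `b ⊗ h ↦ h S⁻¹(b₁) ⊗ b₀` of `cotensorTwist`. -/
def cotensorUntwist : Bᵐᵒᵖ ⊗[k] H →ₗ[k] H ⊗[k] Bᵐᵒᵖ :=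
  TensorProduct.lift (LinearMap.mk₂ k (fun b h =>
    (LinearMap.mulLeft k h).rTensor Bᵐᵒᵖ (opCoact k H B b)) (by simp) (by simp)
    (fun b h h' => by
      rw [show LinearMap.mulLeft k (h + h') = LinearMap.mulLeft k h + LinearMap.mulLeft k h' by
        ext; simp [add_mul], LinearMap.rTensor_add, LinearMap.add_apply])
    (fun c h b => by
      rw [show LinearMap.mulLeft k (c • b) = c • LinearMap.mulLeft k b by
        ext; simp, LinearMap.rTensor_smul, LinearMap.smul_apply]))

theorem cotensorUntwist_cotensorTwist (z : H ⊗[k] Bᵐᵒᵖ) :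
    cotensorUntwist k H B (cotensorTwist k H B z) = z := by
  induction z with
  | zero => simp
  | add x y hx hy => simp only [map_add, hx, hy]
  | tmul h b =>
    induction b with | h b =>
    have h1 (p : B ⊗[k] H) : cotensorUntwist k H B
        (TensorProduct.map (MulOpposite.opLinearEquiv k).toLinearMap (LinearMap.mulLeft k h) p) =
        TensorProduct.map (LinearMap.mulLeft k h) (MulOpposite.opLinearEquiv k).toLinearMap
        (TensorProduct.comm k B H ((TensorProduct.lift ((LinearMap.mul k H).flip ∘ₗ
      ((antipodeInv k H).toLinearMap ∘ₗ (MulOpposite.opLinearEquiv k).toLinearMap))).lTensor B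
          (TensorProduct.assoc k B H H ((coact k H B).toLinearMap.rTensor H p)))) := by
      induction p with
      | zero => simp
      | add x y hx hy => simp only [map_add, hx, hy]
      | tmul b g =>
        simp only [cotensorUntwist, TensorProduct.map_tmul, LinearEquiv.coe_coe,
          MulOpposite.coe_opLinearEquiv, LinearMap.mulLeft_apply, TensorProduct.lift.tmul,
          LinearMap.mk₂_apply, LinearMap.rTensor_tmul, AlgHom.toLinearMap_apply, opCoact_op]
        induction coact k H B b with
        | zero => simp
        | add x y hx hy => simp only [map_add, TensorProduct.add_tmul, hx, hy]
        | tmul b h => simp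
    have h2 (p : B ⊗[k] H) : (TensorProduct.lift ((LinearMap.mul k H).flip ∘ₗ
        ((antipodeInv k H).toLinearMap ∘ₗ (MulOpposite.opLinearEquiv k).toLinearMap))).lTensor B
          ((Coalgebra.comul (R := k) (A := H)).lTensor B p) =
        (TensorProduct.rid k B ((Coalgebra.counit (R := k) (A := H)).lTensor B p)) ⊗ₜ 1 := by
      induction p with
      | zero => simp
      | add x y hx hy => simp only [map_add, TensorProduct.add_tmul, hx, hy]
      | tmul b h =>
        rw [LinearMap.lTensor_tmul, LinearMap.lTensor_tmul, mul_antipodeInv_comul]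
        simp [Algebra.algebraMap_eq_smul_one, TensorProduct.smul_tmul]
    rw [cotensorTwist_tmul, h1, ComoduleAlgebra.coassoc, h2, ComoduleAlgebra.counit]
    simp

variable (k H A B) in
/-- The coaction `a ⊗ b ↦ (a₀ ⊗ b₀) ⊗ a₁ b₁` on `A ⊗ Bᵒᵖ`. -/
def enveloCoact : A ⊗[k] Bᵐᵒᵖ →ₗ[k] (A ⊗[k] Bᵐᵒᵖ) ⊗[k] H :=
  (biDiag H (Algebra.lmul k (A ⊗[k] Bᵐᵒᵖ))).toLinearMap.flip (1 ⊗ₜ 1)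

omit [BijectiveAntipode k H] in
theorem enveloCoact_apply (x : A ⊗[k] Bᵐᵒᵖ) :
    enveloCoact k H A B x = biDiag H (Algebra.lmul k (A ⊗[k] Bᵐᵒᵖ)) x (1 ⊗ₜ 1) := rfl

/-- The cotensor product `A □_H Bᵒᵖ` consists of the coinvariants of `A ⊗ Bᵒᵖ`. -/
theorem mem_cotensorOp_iff (x : A ⊗[k] Bᵐᵒᵖ) :
    x ∈ cotensorOp k H A B ↔ enveloCoact k H A B x = x ⊗ₜ 1 := by
  have h1 : TensorProduct.assoc k A Bᵐᵒᵖ H (enveloCoact k H A B x) =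
      (cotensorTwist k H B).lTensor A (TensorProduct.assoc k A H Bᵐᵒᵖ
        ((coact k H A).toLinearMap.rTensor Bᵐᵒᵖ x)) := by
    induction x with
    | zero => simp
    | add x y hx hy => simp only [map_add, hx, hy]
    | tmul a b =>
      induction b with | h b =>
      rw [enveloCoact_apply, biDiag_tmul, diagAct_apply, rdiagAct_op]
      simp only [LinearMap.rTensor_tmul, AlgHom.toLinearMap_apply]
      induction coact k H A a with
      | zero => simp
      | add x y hx hy => simp only [map_add, LinearMap.add_apply, TensorProduct.add_tmul, hx, hy]
      | tmul a h =>
        simp only [TensorProduct.assoc_tmul, LinearMap.lTensor_tmul, cotensorTwist_tmul]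
        induction coact k H B b with
        | zero => simp
        | add x y hx hy =>
          simp only [map_add, MulOpposite.op_add, LinearMap.add_apply, TensorProduct.tmul_add,
            hx, hy]
        | tmul b g =>
          simp [Algebra.TensorProduct.one_def, leftPart_apply, rightPart_apply]
  have h2 : TensorProduct.assoc k A Bᵐᵒᵖ H (x ⊗ₜ 1) = (cotensorTwist k H B).lTensor A
      ((opCoact k H B).toLinearMap.lTensor A x) := by
    clear h1
    induction x with
    | zero => simp
    | add x y hx hy => simp only [map_add, TensorProduct.add_tmul, hx, hy]
    | tmul a b => simp [cotensorTwist_opCoact]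
  have h3 : Function.Injective ((cotensorTwist k H B).lTensor A) := by
    apply Function.LeftInverse.injective (g := (cotensorUntwist k H B).lTensor A)
    intro z
    rw [← LinearMap.comp_apply, ← LinearMap.lTensor_comp]
    have : cotensorUntwist k H B ∘ₗ cotensorTwist k H B = LinearMap.id :=
      LinearMap.ext cotensorUntwist_cotensorTwist
    rw [this, LinearMap.lTensor_id, LinearMap.id_apply]
  rw [← (TensorProduct.assoc k A Bᵐᵒᵖ H).injective.eq_iff, h1, h2, h3.eq_iff, cotensorOp,
    AlgHom.mem_equalizer]
  rfl

end Cotensor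

/-! ### The induced module `F(M₁)` -/

section Ind

variable {k H A B M₁ : Type*} [CommRing k] [Ring H] [HopfAlgebra k H]
  [BijectiveAntipode k H] [Ring A] [Algebra k A] [ComoduleAlgebra k H A]
  [Ring B] [Algebra k B] [ComoduleAlgebra k H B]
  [AddCommGroup M₁] [Module k M₁] [Module (coinv k H A) M₁] [Module (coinv k H B)ᵐᵒᵖ M₁]

/-- The action of `A ⊗ Bᵒᵖ` on `F(M₁)` as an algebra map. -/
def BoxModule.indHom (μ : BoxModule k H A B M₁) : A ⊗[k] Bᵐᵒᵖ →ₐ[k] Module.End k μ.Ind :=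
  AlgHom.ofLinearMap μ.indActₗ
    (by
      refine BalTensor.hom_ext fun x m => ?_
      simp [BoxModule.indActₗ, BoxModule.indAct, BalTensor.tmul])
    (fun x y => LinearMap.ext fun z => μ.indAct_mul x y z)

theorem BoxModule.indHom_apply (μ : BoxModule k H A B M₁) (x : A ⊗[k] Bᵐᵒᵖ) :
    μ.indHom x = μ.indAct x := rfl

theorem BoxModule.indHom_mul (μ : BoxModule k H A B M₁) (x y : A ⊗[k] Bᵐᵒᵖ) (z : μ.Ind) :
    μ.indHom (x * y) z = μ.indHom x (μ.indHom y z) :=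
  μ.indAct_mul x y z

theorem BoxModule.indHom_unit (μ : BoxModule k H A B M₁) (t : cotensorOp k H A B) (m : M₁) :
    μ.indHom (t : A ⊗[k] Bᵐᵒᵖ) (μ.unit m) = μ.unit (μ.act t m) := μ.indAct_unit t m

theorem BoxModule.indHom_unit_left (μ : BoxModule k H A B M₁) (a : coinv k H A) (m : M₁) :
    μ.indHom ((a : A) ⊗ₜ 1) (μ.unit m) = μ.unit (a • m) := by
  have h := μ.indHom_unit (coinvTmul a 1) m
  rw [μ.act_coinv] at h
  simpa [coinvTmul] using h

theorem BoxModule.indHom_unit_right (μ : BoxModule k H A B M₁) (b : coinv k H B) (m : M₁) :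
    μ.indHom (1 ⊗ₜ MulOpposite.op (b : B)) (μ.unit m) = μ.unit (MulOpposite.op b • m) := by
  have h := μ.indHom_unit (coinvTmul 1 b) m
  rw [μ.act_coinv] at h
  simpa [coinvTmul] using h

/-- `F(M₁)` is generated by `η(M₁)`: the class of `x ⊗ m` is `x η(m)`. -/
theorem BoxModule.tmul_eq (μ : BoxModule k H A B M₁) (x : A ⊗[k] Bᵐᵒᵖ) (m : M₁) :
    (BalTensor.tmul _ _ x m : μ.Ind) = μ.indHom x (μ.unit m) := by
  simp [indHom_apply, BoxModule.unit, BoxModule.indAct, BalTensor.tmul]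

omit [BijectiveAntipode k H] in
theorem enveloCoact_mul (x y : A ⊗[k] Bᵐᵒᵖ) : enveloCoact k H A B (x * y) =
    biDiag H (Algebra.lmul k (A ⊗[k] Bᵐᵒᵖ)) x (enveloCoact k H A B y) := by
  simp [enveloCoact_apply]

omit [BijectiveAntipode k H] in
theorem enveloCoact_one : enveloCoact k H A B 1 = 1 ⊗ₜ 1 := by
  simp [enveloCoact_apply]

omit [BijectiveAntipode k H] in
theorem enveloCoact_leftMul (a : A) (x : A ⊗[k] Bᵐᵒᵖ) :
    enveloCoact k H A B (leftPart (Algebra.lmul k (A ⊗[k] Bᵐᵒᵖ)) a x) =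
      diagAct H (leftPart (Algebra.lmul k (A ⊗[k] Bᵐᵒᵖ))) a (enveloCoact k H A B x) := by
  rw [← leftPart_biDiag, leftPart_apply, leftPart_apply, ← enveloCoact_mul]
  rfl

/-- The coinvariants of `A ⊗ Bᵒᵖ`, as elements of the cotensor product. -/
def coinvToCotensor : coinvSub (enveloCoact k H A B) →ₗ[k] cotensorOp k H A B where
  toFun x := ⟨x, (mem_cotensorOp_iff _).2 (mem_coinvSub.1 x.2)⟩
  map_add' _ _ := rfl
  map_smul' _ _ := rfl

theorem indCoact_balanced (μ : BoxModule k H A B M₁) (t : cotensorOp k H A B)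
    (x : A ⊗[k] Bᵐᵒᵖ) (m : M₁) :
    (biDiag H μ.indHom).toLinearMap.compl₂ ((TensorProduct.mk k μ.Ind H).flip 1 ∘ₗ μ.unit)
      (LinearMap.mulRight k (t : A ⊗[k] Bᵐᵒᵖ) x) m =
    (biDiag H μ.indHom).toLinearMap.compl₂ ((TensorProduct.mk k μ.Ind H).flip 1 ∘ₗ μ.unit) x
      (μ.act t m) := by
  have h := rTensor_biDiag (H := H) (Algebra.lmul k (A ⊗[k] Bᵐᵒᵖ)) μ.indHom
    (μ.indHom.toLinearMap.flip (μ.unit m)) (by simp) (t : A ⊗[k] Bᵐᵒᵖ) (1 ⊗ₜ 1)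
  rw [← enveloCoact_apply, (mem_cotensorOp_iff _).1 t.2] at h
  simp only [LinearMap.rTensor_tmul, LinearMap.flip_apply, AlgHom.toLinearMap_apply, map_one,
    Module.End.one_apply, μ.indHom_unit] at h
  simp [h]

/-- The coaction `x ⊗ m ↦ x₀ ⊗ m ⊗ x₁` on `F(M₁)`. -/
def BoxModule.indCoact (μ : BoxModule k H A B M₁) : μ.Ind →ₗ[k] μ.Ind ⊗[k] H :=
  BalTensor.lift ((biDiag H μ.indHom).toLinearMap.compl₂
    ((TensorProduct.mk k μ.Ind H).flip 1 ∘ₗ μ.unit)) (indCoact_balanced μ)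

theorem BoxModule.indCoact_tmul (μ : BoxModule k H A B M₁) (x : A ⊗[k] Bᵐᵒᵖ) (m : M₁) :
    μ.indCoact (BalTensor.tmul _ _ x m) = biDiag H μ.indHom x (μ.unit m ⊗ₜ 1) :=
  BalTensor.lift_tmul _ _ _ _

theorem BoxModule.indCoact_unit (μ : BoxModule k H A B M₁) (m : M₁) :
    μ.indCoact (μ.unit m) = μ.unit m ⊗ₜ 1 := by
  have h := μ.indCoact_tmul 1 m
  rw [μ.tmul_eq] at h
  simpa using h

theorem BoxModule.indCoact_indHom (μ : BoxModule k H A B M₁) (x : A ⊗[k] Bᵐᵒᵖ) (z : μ.Ind) :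
    μ.indCoact (μ.indHom x z) = biDiag H μ.indHom x (μ.indCoact z) := by
  induction z using BalTensor.induction with
  | zero => simp
  | add y z hy hz => simp only [map_add, hy, hz]
  | tmul y m =>
    rw [μ.indCoact_tmul, ← Module.End.mul_apply, ← map_mul, ← μ.indCoact_tmul, μ.tmul_eq, μ.tmul_eq,
      ← Module.End.mul_apply, ← map_mul]

theorem BoxModule.indCoact_left (μ : BoxModule k H A B M₁) (a : A) (z : μ.Ind) :
    μ.indCoact (μ.indHom (a ⊗ₜ 1) z) = actH H (leftPart μ.indHom) (coact k H A a) (μ.indCoact z) := by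
  rw [μ.indCoact_indHom, biDiag_tmul, map_one, Module.End.one_apply, diagAct_apply]

theorem BoxModule.indCoact_right (μ : BoxModule k H A B M₁) (b : B) (z : μ.Ind) :
    μ.indCoact (μ.indHom (1 ⊗ₜ MulOpposite.op b) z) =
      ractH H (rightPart μ.indHom) (MulOpposite.op (coact k H B b)) (μ.indCoact z) := by
  rw [μ.indCoact_indHom, biDiag_tmul, map_one, Module.End.one_apply, rdiagAct_op]

theorem BoxModule.indCoact_coassoc (μ : BoxModule k H A B M₁) (z : μ.Ind) :
    TensorProduct.assoc k μ.Ind H H (μ.indCoact.rTensor H (μ.indCoact z)) =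
      (Coalgebra.comul (R := k) (A := H)).lTensor μ.Ind (μ.indCoact z) := by
  induction z using BalTensor.induction with
  | zero => simp
  | add y z hy hz => simp only [map_add, hy, hz]
  | tmul y m => rw [μ.tmul_eq, coassoc_of_coinv μ.indCoact_indHom (μ.indCoact_unit m)]

theorem BoxModule.indCoact_counit (μ : BoxModule k H A B M₁) (z : μ.Ind) :
    TensorProduct.rid k μ.Ind ((Coalgebra.counit (R := k) (A := H)).lTensor μ.Ind (μ.indCoact z)) =
      z := by
  induction z using BalTensor.induction with
  | zero => simp
  | add y z hy hz => simp only [map_add, hy, hz]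
  | tmul y m => rw [μ.tmul_eq, counit_of_coinv μ.indCoact_indHom (μ.indCoact_unit m)]

end Ind

section IndLift

variable {k H A B M₁ W : Type u} [CommRing k] [Ring H] [HopfAlgebra k H]
  [BijectiveAntipode k H] [Ring A] [Algebra k A] [ComoduleAlgebra k H A]
  [Ring B] [Algebra k B] [ComoduleAlgebra k H B]
  [AddCommGroup M₁] [Module k M₁] [Module (coinv k H A) M₁] [Module (coinv k H B)ᵐᵒᵖ M₁]
  [AddCommGroup W] [Module k W]

omit [BijectiveAntipode k H] in
/-- The structure theorem for `A ⊗ Bᵒᵖ`: multiplication is an isomorphism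
`A ⊗_{A^{co H}} (A □_H Bᵒᵖ) ≃ A ⊗ Bᵒᵖ`. -/
theorem coinvMul_envelo_bijective (hA : IsRightFaithfullyFlatGalois k H A) :
    Function.Bijective (coinvMul (enveloCoact_leftMul (k := k) (H := H) (A := A) (B := B))) := by
  have h (x y : A ⊗[k] Bᵐᵒᵖ) : enveloCoact k H A B (Algebra.lmul k _ x y) =
      biDiag H (Algebra.lmul k (A ⊗[k] Bᵐᵒᵖ)) x (enveloCoact k H A B y) := enveloCoact_mul x y
  refine coinvMul_bijective hA (fun x => ?_) (fun x => ?_) enveloCoact_leftMul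
  · have := coassoc_of_coinv h enveloCoact_one x
    simpa using this
  · have := counit_of_coinv h enveloCoact_one x
    simpa using this

theorem envelo_induction (hA : IsRightFaithfullyFlatGalois k H A) {p : A ⊗[k] Bᵐᵒᵖ → Prop}
    (add : ∀ x y, p x → p y → p (x + y))
    (mul : ∀ (a : A) (t : cotensorOp k H A B), p (a ⊗ₜ 1 * (t : A ⊗[k] Bᵐᵒᵖ))) (x : A ⊗[k] Bᵐᵒᵖ) : p x := by
  obtain ⟨z, rfl⟩ := (coinvMul_envelo_bijective (B := B) hA).2 x
  induction z using BalTensor.induction with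
  | zero => simpa using mul 0 0
  | add x y hx hy => simpa only [map_add] using add _ _ hx hy
  | tmul a t =>
    rw [coinvMul_tmul]
    exact mul a (coinvToCotensor t)

/-- `F(M₁)` is generated by `η(M₁)` as a left `A`-module. -/
theorem BoxModule.ind_induction (hA : IsRightFaithfullyFlatGalois k H A)
    (μ : BoxModule k H A B M₁) {p : μ.Ind → Prop}
    (add : ∀ x y, p x → p y → p (x + y))
    (unit : ∀ (a : A) (m : M₁), p (μ.indHom (a ⊗ₜ 1) (μ.unit m))) (z : μ.Ind) : p z := by
  induction z using BalTensor.induction with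
  | zero => simpa using unit 0 0
  | add x y hx hy => exact add _ _ hx hy
  | tmul x m =>
    rw [μ.tmul_eq]
    induction x using envelo_induction (B := B) hA with
    | add x y hx hy => simpa only [map_add, LinearMap.add_apply] using add _ _ hx hy
    | mul a t =>
      rw [map_mul, Module.End.mul_apply, μ.indHom_unit]
      exact unit a _

theorem BoxModule.ind_hom_ext (hA : IsRightFaithfullyFlatGalois k H A)
    (μ : BoxModule k H A B M₁) (L : A →ₐ[k] Module.End k W) {f g : μ.Ind →ₗ[k] W}
    (hf : ∀ a z, f (μ.indHom (a ⊗ₜ 1) z) = L a (f z))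
    (hg : ∀ a z, g (μ.indHom (a ⊗ₜ 1) z) = L a (g z))
    (h : ∀ m, f (μ.unit m) = g (μ.unit m)) : f = g := by
  refine LinearMap.ext fun z => ?_
  induction z using μ.ind_induction hA with
  | add x y hx hy => simp only [map_add, hx, hy]
  | unit a m => rw [hf, hg, h]

/-- The universal property of `F(M₁) ≃ A ⊗_{A^{co H}} M₁` as a left `A`-module: every left
`A^{co H}`-linear map from `M₁` to an `A`-module extends to `F(M₁)`. -/
theorem BoxModule.exists_ind_lift (hA : IsRightFaithfullyFlatGalois k H A)
    (μ : BoxModule k H A B M₁) (L : A →ₐ[k] Module.End k W) (φ : M₁ →ₗ[k] W)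
    (hφ : ∀ (s : coinv k H A) m, φ (s • m) = L (s : A) (φ m)) :
    ∃ Φ : μ.Ind →ₗ[k] W, (∀ a z, Φ (μ.indHom (a ⊗ₜ 1) z) = L a (Φ z)) ∧
      ∀ m, Φ (μ.unit m) = φ m := by
  let b : A →ₗ[k] coinvSub (enveloCoact k H A B) →ₗ[k] M₁ →ₗ[k] W :=
    LinearMap.mk₂ k (fun a c => L a ∘ₗ φ ∘ₗ μ.act (coinvToCotensor c))
      (fun a a' c => by ext; simp) (fun r a c => by ext; simp)
      (fun a c c' => by ext; simp) (fun r a c => by ext; simp)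
  have b_apply (a c m) : b a c m = L a (φ (μ.act (coinvToCotensor c) m)) := rfl
  have hb (s : coinv k H A) (a : A) (c : coinvSub (enveloCoact k H A B)) :
      b (coinvMulRight k H A s a) c = b a (restrictAct
        (coinvAct H (leftPart (Algebra.lmul k (A ⊗[k] Bᵐᵒᵖ)))) _
        (coinvSub_stable enveloCoact_leftMul) s c) := by
    ext m
    have h1 : coinvToCotensor (restrictAct
        (coinvAct H (leftPart (Algebra.lmul k (A ⊗[k] Bᵐᵒᵖ)))) _
        (coinvSub_stable enveloCoact_leftMul) s c) = coinvTmul s 1 * coinvToCotensor c :=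
      Subtype.ext (by simp [coinvToCotensor, coinvTmul, leftPart_apply])
    rw [b_apply, b_apply, h1, map_mul, Module.End.mul_apply, μ.act_coinv]
    simp [hφ]
  let e := LinearEquiv.ofBijective _ (coinvMul_envelo_bijective (B := B) hA)
  let G : A ⊗[k] Bᵐᵒᵖ →ₗ[k] M₁ →ₗ[k] W := BalTensor.lift b hb ∘ₗ e.symm.toLinearMap
  have hG (a : A) (t : cotensorOp k H A B) (m : M₁) :
      G (a ⊗ₜ 1 * (t : A ⊗[k] Bᵐᵒᵖ)) m = L a (φ (μ.act t m)) := by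
    let c : coinvSub (enveloCoact k H A B) := ⟨t, mem_coinvSub.2 ((mem_cotensorOp_iff _).1 t.2)⟩
    have h1 : e.symm (a ⊗ₜ 1 * (t : A ⊗[k] Bᵐᵒᵖ)) = BalTensor.tmul _ _ a c := by
      rw [LinearEquiv.symm_apply_eq]
      exact (coinvMul_tmul (L := leftPart (Algebra.lmul k (A ⊗[k] Bᵐᵒᵖ)))
        enveloCoact_leftMul a c).symm
    change BalTensor.lift b hb (e.symm _) m = _
    rw [h1, BalTensor.lift_tmul, b_apply]
    rfl
  have hGb (t : cotensorOp k H A B) (x : A ⊗[k] Bᵐᵒᵖ) (m : M₁) :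
      G (LinearMap.mulRight k (t : A ⊗[k] Bᵐᵒᵖ) x) m = G x (μ.act t m) := by
    induction x using envelo_induction (B := B) hA with
    | add x y hx hy => simp only [map_add, LinearMap.add_apply, hx, hy]
    | mul a t' =>
      have := hG a (t' * t) m
      rw [hG, LinearMap.mulRight_apply, mul_assoc]
      simpa using this
  refine ⟨BalTensor.lift G hGb, fun a z => ?_, fun m => ?_⟩
  · induction z using BalTensor.induction with
    | zero => simp
    | add x y hx hy => simp only [map_add, hx, hy]
    | tmul x m =>
      have h1 : μ.indHom (a ⊗ₜ 1) (BalTensor.tmul _ _ x m) =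
          BalTensor.tmul _ _ ((a ⊗ₜ 1) * x) m := by
        rw [μ.tmul_eq, μ.tmul_eq, map_mul, Module.End.mul_apply]
      rw [h1, BalTensor.lift_tmul, BalTensor.lift_tmul]
      induction x using envelo_induction (B := B) hA with
      | add x y hx hy =>
        simp only [map_add, mul_add, LinearMap.add_apply,
          hx (by rw [μ.tmul_eq, μ.tmul_eq, map_mul, Module.End.mul_apply]),
          hy (by rw [μ.tmul_eq, μ.tmul_eq, map_mul, Module.End.mul_apply])]
      | mul a' t =>
        rw [← mul_assoc, Algebra.TensorProduct.tmul_mul_tmul, mul_one, hG, hG, map_mul,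
          Module.End.mul_apply]
  · have h1 : μ.unit m = BalTensor.tmul _ _ 1 m := by simp [μ.tmul_eq]
    rw [h1, BalTensor.lift_tmul]
    simpa [← Algebra.TensorProduct.one_def] using hG 1 1 m

end IndLift

/-! ### Strict Morita contexts -/

section MoritaGeneral

variable {k R S M N : Type*} [CommRing k] [Ring R] [Algebra k R] [Ring S] [Algebra k S]
  [AddCommGroup M] [Module k M] [Module R M] [IsScalarTower k R M]
  [Module Sᵐᵒᵖ M] [IsScalarTower k Sᵐᵒᵖ M]
  [AddCommGroup N] [Module k N] [Module S N] [IsScalarTower k S N]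
  [Module Rᵐᵒᵖ N] [IsScalarTower k Rᵐᵒᵖ N]
  [SMulCommClass R Sᵐᵒᵖ M] [SMulCommClass S Rᵐᵒᵖ N]

/-- The Morita context with the two rings exchanged. -/
def MoritaContext.swap (X : MoritaContext k R S M N) : MoritaContext k S R N M where
  α := X.β
  β := X.α
  α_left := X.β_left
  α_right := X.β_right
  β_left := X.α_left
  β_right := X.α_right
  α_β := X.β_α
  β_α := X.α_β

/-- The bilinear map `(m, n) ↦ α(m ⊗ n)`. -/
def MoritaContext.pair (X : MoritaContext k R S M N) : M →ₗ[k] N →ₗ[k] R :=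
  (BalTensor.mk _ _).compr₂ X.α

theorem MoritaContext.α_tmul (X : MoritaContext k R S M N) (m : M) (n : N) :
    X.α (tmulOver k S m n) = X.pair m n := rfl

theorem MoritaContext.pair_smul_left (X : MoritaContext k R S M N) (r : R) (m : M) (n : N) :
    X.pair (r • m) n = r * X.pair m n := X.α_left r m n

theorem MoritaContext.pair_smul_right (X : MoritaContext k R S M N) (r : R) (m : M) (n : N) :
    X.pair m (MulOpposite.op r • n) = X.pair m n * r := X.α_right r m n

theorem MoritaContext.pair_smul_mid (X : MoritaContext k R S M N) (s : S) (m : M) (n : N) :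
    X.pair (MulOpposite.op s • m) n = X.pair m (s • n) :=
  congrArg X.α (BalTensor.smul_tmul _ _ s m n)

theorem MoritaContext.pair_smul (X : MoritaContext k R S M N) (m : M) (n : N) (m' : M) :
    X.pair m n • m' = MulOpposite.op (X.swap.pair n m') • m := X.α_β m n m'

theorem BalTensor.exists_sum {k R M N : Type*} [CommRing k] [AddCommGroup M] [Module k M]
    [AddCommGroup N] [Module k N] {ρ : R → Module.End k M} {l : R → Module.End k N}
    (z : BalTensor k ρ l) :
    ∃ (ι : Type) (_ : Fintype ι) (m : ι → M) (n : ι → N), z = ∑ i, BalTensor.tmul ρ l (m i) (n i) := by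
  induction z using BalTensor.induction with
  | zero => exact ⟨Empty, inferInstance, Empty.elim, Empty.elim, by simp⟩
  | add x y hx hy =>
    obtain ⟨ι, _, m, n, rfl⟩ := hx
    obtain ⟨ι', _, m', n', rfl⟩ := hy
    exact ⟨ι ⊕ ι', inferInstance, Sum.elim m m', Sum.elim n n', by simp⟩
  | tmul m n => exact ⟨Unit, inferInstance, fun _ => m, fun _ => n, by simp⟩

theorem MoritaContext.exists_sum_pair_eq_one {X : MoritaContext k R S M N}
    (hX : Function.Surjective X.α) :
    ∃ (ι : Type) (_ : Fintype ι) (m : ι → M) (n : ι → N), ∑ i, X.pair (m i) (n i) = 1 := by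
  obtain ⟨z, hz⟩ := hX 1
  obtain ⟨ι, _, m, n, rfl⟩ := BalTensor.exists_sum z
  exact ⟨ι, inferInstance, m, n, by rw [← hz, map_sum]; rfl⟩

theorem MoritaContext.IsStrict.swap {X : MoritaContext k R S M N} (hX : X.IsStrict) :
    X.swap.IsStrict := ⟨hX.2, hX.1⟩

theorem MoritaContext.IsStrict.eq_zero_right {X : MoritaContext k R S M N} (hX : X.IsStrict)
    {n : N} (h : ∀ m, X.pair m n = 0) : n = 0 := by
  obtain ⟨ι, _, n', m', h1⟩ := exists_sum_pair_eq_one hX.swap.1.2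
  rw [← one_smul S n, ← h1, Finset.sum_smul]
  refine Finset.sum_eq_zero fun i _ => ?_
  rw [X.swap.pair_smul]
  change MulOpposite.op (X.pair _ _) • _ = _
  simp [h]

theorem MoritaContext.IsStrict.eq_zero_left {X : MoritaContext k R S M N} (hX : X.IsStrict)
    {m : M} (h : ∀ n, X.pair m n = 0) : m = 0 := by
  obtain ⟨ι, _, n', m', h1⟩ := exists_sum_pair_eq_one hX.swap.1.2
  rw [← one_smul Sᵐᵒᵖ m, ← MulOpposite.op_one, ← h1, Finset.op_sum, Finset.sum_smul]
  refine Finset.sum_eq_zero fun i _ => ?_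
  rw [← X.pair_smul, h, zero_smul]

/-- In a strict Morita context every left `R`-linear form on `M` is `m ↦ α(m ⊗ n)` for some
`n`. -/
theorem MoritaContext.IsStrict.exists_repr {X : MoritaContext k R S M N} (hX : X.IsStrict)
    (φ : M → R) (hadd : ∀ m m', φ (m + m') = φ m + φ m') (hφ : ∀ (r : R) m, φ (r • m) = r * φ m) :
    ∃ n, ∀ m, X.pair m n = φ m := by
  obtain ⟨ι, _, n', m', h1⟩ := exists_sum_pair_eq_one hX.swap.1.2
  let φ' : M →+ R := AddMonoidHom.mk' φ hadd
  refine ⟨∑ i, MulOpposite.op (φ (m' i)) • n' i, fun m => ?_⟩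
  have h2 : m = ∑ i, X.pair m (n' i) • m' i := by
    simp only [X.pair_smul]
    rw [← Finset.sum_smul, ← Finset.op_sum, h1, MulOpposite.op_one, one_smul]
  conv_rhs => rw [h2]
  change _ = φ' _
  rw [map_sum, map_sum]
  refine Finset.sum_congr rfl fun i _ => ?_
  rw [X.pair_smul_right]
  exact (hφ _ _).symm

end MoritaGeneral

/-- A subspace embedded in a module and stable under the action inherits the action. -/
theorem exists_act_of_injective {k T N W : Type*} [CommRing k] [Ring T] [Algebra k T]
    [AddCommGroup N] [Module k N] [AddCommGroup W] [Module k W] (Γ : T →ₐ[k] Module.End k W)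
    {f : N →ₗ[k] W} (hf : Function.Injective f) (h : ∀ t n, ∃ n', f n' = Γ t (f n)) :
    ∃ act : T →ₐ[k] Module.End k N, ∀ t n, f (act t n) = Γ t (f n) := by
  choose g hg using h
  refine ⟨AlgHom.ofLinearMap
    { toFun := fun t =>
        { toFun := g t
          map_add' := fun x y => hf (by simp [hg])
          map_smul' := fun c x => hf (by simp [hg]) }
      map_add' := fun s t => LinearMap.ext fun x => hf (by simp [hg])
      map_smul' := fun c t => LinearMap.ext fun x => hf (by simp [hg]) }
    (LinearMap.ext fun x => hf (by simp [hg]))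
    (fun s t => LinearMap.ext fun x => hf (by simp [hg])), fun t n => hg t n⟩

/-! ### The action on dual modules -/

section HomAct

variable {k A B V W : Type*} [CommRing k] [Ring A] [Algebra k A] [Ring B] [Algebra k B]
  [AddCommGroup V] [Module k V] [AddCommGroup W] [Module k W]

/-- The left action `(b g)(v) = g(v b)` of `B` on `Hom(V, W)` for a right `B`-module `V`. -/
def precompAct (W : Type*) [AddCommGroup W] [Module k W] (R : Bᵐᵒᵖ →ₐ[k] Module.End k V) :
    B →ₐ[k] Module.End k (V →ₗ[k] W) :=
  AlgHom.ofLinearMap ((LinearMap.llcomp k V V W).flip ∘ₗ R.toLinearMap ∘ₗ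
    (MulOpposite.opLinearEquiv k).toLinearMap) (by ext; simp) (fun b c => by ext; simp)

@[simp]
theorem precompAct_apply (R : Bᵐᵒᵖ →ₐ[k] Module.End k V) (b : B) (g : V →ₗ[k] W) (v : V) :
    precompAct W R b g v = g (R (MulOpposite.op b) v) := rfl

/-- The right action `(g a)(v) = g(v) a` of `A` on `Hom(V, A)`. -/
def postcompAct (k A V : Type*) [CommRing k] [Ring A] [Algebra k A] [AddCommGroup V] [Module k V] :
    Aᵐᵒᵖ →ₐ[k] Module.End k (V →ₗ[k] A) :=
  AlgHom.ofLinearMap (LinearMap.llcomp k V A A ∘ₗ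
    (Algebra.lsmul k k A : Aᵐᵒᵖ →ₐ[k] Module.End k A).toLinearMap)
    (by ext; simp) (fun b c => by ext; simp)

theorem precompAct_postcompAct_commute (R : Bᵐᵒᵖ →ₐ[k] Module.End k V) (b : B) (a : Aᵐᵒᵖ) :
    Commute (precompAct A R b) (postcompAct k A V a) := rfl

/-- The `(B, A)`-bimodule `Hom(V, A)` for an `(A, B)`-bimodule `V`: `(b g a)(v) = g(v b) a`. -/
def homAct (L : A ⊗[k] Bᵐᵒᵖ →ₐ[k] Module.End k V) :
    B ⊗[k] Aᵐᵒᵖ →ₐ[k] Module.End k (V →ₗ[k] A) :=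
  Algebra.TensorProduct.lift (precompAct A (rightPart L)) (postcompAct k A V)
    (precompAct_postcompAct_commute (rightPart L))

@[simp]
theorem homAct_tmul (L : A ⊗[k] Bᵐᵒᵖ →ₐ[k] Module.End k V) (b : B) (a : Aᵐᵒᵖ) (g : V →ₗ[k] A)
    (v : V) : homAct L (b ⊗ₜ a) g v = g (L (1 ⊗ₜ MulOpposite.op b) v) * a.unop := by
  rw [homAct, Algebra.TensorProduct.lift_tmul]
  rfl

/-- `homAct` preserves left `A`-linear maps. -/
theorem homAct_left {L : A ⊗[k] Bᵐᵒᵖ →ₐ[k] Module.End k V} {g : V →ₗ[k] A}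
    (hg : ∀ a v, g (L (a ⊗ₜ 1) v) = a * g v) (x : B ⊗[k] Aᵐᵒᵖ) (a : A) (v : V) :
    homAct L x g (L (a ⊗ₜ 1) v) = a * homAct L x g v := by
  induction x with
  | zero => simp
  | add x y hx hy => simp only [map_add, LinearMap.add_apply, hx, hy, mul_add]
  | tmul b a' =>
    rw [homAct_tmul, homAct_tmul, ← Module.End.mul_apply, ← map_mul]
    have : ((1 : A) ⊗ₜ[k] MulOpposite.op b) * (a ⊗ₜ 1) = (a ⊗ₜ 1) * (1 ⊗ₜ MulOpposite.op b) := by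
      simp
    rw [this, map_mul, Module.End.mul_apply, hg, mul_assoc]

end HomAct

section Coaction

variable {k H A : Type*} [CommRing k] [Ring H] [HopfAlgebra k H] [Ring A] [Algebra k A]

theorem actH_lmul (p q : A ⊗[k] H) : actH H (Algebra.lmul k A) p q = p * q := by
  induction p with
  | zero => simp
  | add x y hx hy => simp [add_mul, hx, hy]
  | tmul a h =>
    induction q with
    | zero => simp
    | add x y hx hy => simp only [map_add, hx, hy, mul_add]
    | tmul b g => simp

/-- Elements of `V ⊗ H`, for `H` projective, are separated by the linear forms on `H`. -/
theorem eq_zero_of_forall_dual {V : Type*} [AddCommGroup V] [Module k V] [Module.Projective k H]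
    {z : V ⊗[k] H} (h : ∀ p : H →ₗ[k] k, TensorProduct.rid k V (p.lTensor V z) = 0) : z = 0 := by
  classical
  obtain ⟨s, hs⟩ := Module.projective_def'.1 (inferInstance : Module.Projective k H)
  have hinj : Function.Injective (s.lTensor V) := by
    apply Function.LeftInverse.injective (g := (Finsupp.linearCombination k id).lTensor V)
    intro z
    rw [← LinearMap.comp_apply, ← LinearMap.lTensor_comp, hs, LinearMap.lTensor_id,
      LinearMap.id_apply]
  apply hinj
  rw [map_zero]
  apply (TensorProduct.finsuppScalarRight k k V H).injective
  rw [map_zero]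
  ext i
  have h1 (z : V ⊗[k] H) : TensorProduct.finsuppScalarRight k k V H (s.lTensor V z) i =
      TensorProduct.rid k V ((Finsupp.lapply i ∘ₗ s).lTensor V z) := by
    induction z with
    | zero => simp
    | add x y hx hy => simp only [map_add, Finsupp.add_apply, hx, hy]
    | tmul v h => simp
  rw [h1, h]
  rfl

end Coaction

/-! ### The induced pairing -/

section Pairing

variable {k H A B M₁ N₁ : Type u} [CommRing k] [Ring H] [HopfAlgebra k H]
  [BijectiveAntipode k H]
  [Ring A] [Algebra k A] [ComoduleAlgebra k H A]
  [Ring B] [Algebra k B] [ComoduleAlgebra k H B]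
  [AddCommGroup M₁] [Module k M₁]
  [Module (coinv k H A) M₁] [IsScalarTower k (coinv k H A) M₁]
  [Module (coinv k H B)ᵐᵒᵖ M₁] [IsScalarTower k (coinv k H B)ᵐᵒᵖ M₁]
  [SMulCommClass (coinv k H A) (coinv k H B)ᵐᵒᵖ M₁]
  [AddCommGroup N₁] [Module k N₁]
  [Module (coinv k H B) N₁] [IsScalarTower k (coinv k H B) N₁]
  [Module (coinv k H A)ᵐᵒᵖ N₁] [IsScalarTower k (coinv k H A)ᵐᵒᵖ N₁]
  [SMulCommClass (coinv k H B) (coinv k H A)ᵐᵒᵖ N₁]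

theorem exists_pairHom (hA : IsRightFaithfullyFlatGalois k H A)
    (X : MoritaContext k (coinv k H A) (coinv k H B) M₁ N₁) (μ : BoxModule k H A B M₁) :
    ∃ f : N₁ →ₗ[k] μ.Ind →ₗ[k] A, (∀ n a z, f n (μ.indHom (a ⊗ₜ 1) z) = a * f n z) ∧
      ∀ n m, f n (μ.unit m) = X.pair m n := by
  have h (n : N₁) := μ.exists_ind_lift hA (Algebra.lmul k A)
    ((coinv k H A).val.toLinearMap ∘ₗ X.pair.flip n) (fun s m => by simp [X.pair_smul_left])
  choose f hf₁ hf₂ using h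
  refine ⟨
    { toFun := f
      map_add' := fun n n' => μ.ind_hom_ext hA (Algebra.lmul k A) (hf₁ _)
        (fun a z => by simp [hf₁, mul_add]) (fun m => by simp [hf₂])
      map_smul' := fun c n => μ.ind_hom_ext hA (Algebra.lmul k A) (hf₁ _)
        (fun a z => by simp [hf₁]) (fun m => by simp [hf₂]) }, hf₁, hf₂⟩

/-- For `n : N₁`, the left `A`-linear extension `F(M₁) → A` of `m ↦ α(m ⊗ n)`. -/
def pairHom (hA : IsRightFaithfullyFlatGalois k H A)
    (X : MoritaContext k (coinv k H A) (coinv k H B) M₁ N₁) (μ : BoxModule k H A B M₁) :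
    N₁ →ₗ[k] μ.Ind →ₗ[k] A :=
  (exists_pairHom hA X μ).choose

variable (hA : IsRightFaithfullyFlatGalois k H A) (hB : IsRightFaithfullyFlatGalois k H B)
  (X : MoritaContext k (coinv k H A) (coinv k H B) M₁ N₁) (μ : BoxModule k H A B M₁)
  (ν : BoxModule k H B A N₁)

theorem pairHom_left (n : N₁) (a : A) (z : μ.Ind) :
    pairHom hA X μ n (μ.indHom (a ⊗ₜ 1) z) = a * pairHom hA X μ n z :=
  (exists_pairHom hA X μ).choose_spec.1 n a z

theorem pairHom_unit (n : N₁) (m : M₁) : pairHom hA X μ n (μ.unit m) = X.pair m n :=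
  (exists_pairHom hA X μ).choose_spec.2 n m

theorem pairHom_smul_right (n : N₁) (s : coinv k H A) (z : μ.Ind) :
    pairHom hA X μ (MulOpposite.op s • n) z = pairHom hA X μ n z * s := by
  induction z using μ.ind_induction hA with
  | add x y hx hy => simp only [map_add, hx, hy, add_mul]
  | unit a m => simp only [pairHom_left, pairHom_unit, X.pair_smul_right, Subalgebra.coe_mul, mul_assoc]

theorem pairHom_smul_left (n : N₁) (s : coinv k H B) (z : μ.Ind) :
    pairHom hA X μ (s • n) z =
      pairHom hA X μ n (μ.indHom (1 ⊗ₜ MulOpposite.op (s : B)) z) := by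
  induction z using μ.ind_induction hA with
  | add x y hx hy => simp only [map_add, hx, hy]
  | unit a m =>
    have h : μ.indHom (1 ⊗ₜ MulOpposite.op (s : B)) (μ.indHom (a ⊗ₜ 1) (μ.unit m)) =
        μ.indHom (a ⊗ₜ 1) (μ.indHom (1 ⊗ₜ MulOpposite.op (s : B)) (μ.unit m)) := by
      rw [← Module.End.mul_apply, ← Module.End.mul_apply, ← map_mul, ← map_mul]
      simp
    rw [h, μ.indHom_unit_right, pairHom_left, pairHom_left, pairHom_unit, pairHom_unit,
      X.pair_smul_mid]

variable {X} in
theorem pairHom_injective (hX : X.IsStrict) : Function.Injective (pairHom hA X μ) := by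
  refine (injective_iff_map_eq_zero _).2 fun n hn => hX.eq_zero_right fun m => ?_
  apply Subtype.val_injective
  rw [← pairHom_unit hA X μ, hn]
  simp

/-- The maps `pairHom n : F(M₁) → A` are colinear. -/
theorem coact_pairHom (n : N₁) (z : μ.Ind) :
    coact k H A (pairHom hA X μ n z) = (pairHom hA X μ n).rTensor H (μ.indCoact z) := by
  induction z using μ.ind_induction hA with
  | add x y hx hy => simp only [map_add, hx, hy]
  | unit a m =>
    rw [pairHom_left, map_mul, μ.indCoact_indHom, μ.indCoact_unit, biDiag_tmul, map_one,
      Module.End.one_apply, diagAct_apply,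
      rTensor_actH _ (Algebra.lmul k A) _ (fun a v => pairHom_left hA X μ n a v), actH_lmul,
      LinearMap.rTensor_tmul, pairHom_unit, coact_coinv]

/-- The coaction of `A` on the values of `x · pairHom n`, for `x` in `B ⊗ Aᵒᵖ`. -/
theorem coact_homAct_pairHom (n : N₁) (m : M₁) (Ω : B ⊗[k] Aᵐᵒᵖ →ₗ[k] A)
    (hΩ : ∀ x, Ω x = homAct μ.indHom x (pairHom hA X μ n) (μ.unit m)) (x : B ⊗[k] Aᵐᵒᵖ) :
    coact k H A (Ω x) = Ω.rTensor H (enveloCoact k H B A x) := by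
  induction x with
  | zero => simp
  | add x y hx hy => simp only [map_add, hx, hy]
  | tmul b a =>
    induction a with | h a =>
    rw [hΩ, homAct_tmul, map_mul, coact_pairHom, μ.indCoact_indHom, μ.indCoact_unit, biDiag_tmul,
      map_one, Module.End.one_apply, rdiagAct_op, enveloCoact_apply, biDiag_tmul, diagAct_apply,
      rdiagAct_op, MulOpposite.unop_op]
    generalize coact k H A a = q
    generalize coact k H B b = p
    induction q with
    | zero => simp
    | add q q' hq hq' => simp only [map_add, MulOpposite.op_add, LinearMap.add_apply, mul_add, hq, hq']
    | tmul a g =>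
      induction p with
      | zero => simp
      | add q q' hq hq' =>
        simp only [map_add, MulOpposite.op_add, LinearMap.add_apply, add_mul, hq, hq']
      | tmul b h =>
        simp [Algebra.TensorProduct.one_def, leftPart_apply, rightPart_apply, hΩ]

variable {X} in
/-- The subspace `N₁` of `Hom(F(M₁), A)` is stable under the cotensor product: it consists of the
left `A`-linear maps that take coinvariants to coinvariants. -/
theorem exists_homAct_pairHom (hX : X.IsStrict) (t : cotensorOp k H B A) (n : N₁) :
    ∃ n', pairHom hA X μ n' = homAct μ.indHom t (pairHom hA X μ n) := by
  set h := homAct μ.indHom t (pairHom hA X μ n) with hh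
  have hleft (a : A) (z : μ.Ind) : h (μ.indHom (a ⊗ₜ 1) z) = a * h z :=
    homAct_left (pairHom_left hA X μ n) _ a z
  have hco (m : M₁) : h (μ.unit m) ∈ coinv k H A := by
    have h1 := coact_homAct_pairHom hA X μ n m (LinearMap.applyₗ (μ.unit m) ∘ₗ
      (homAct μ.indHom).toLinearMap.flip (pairHom hA X μ n)) (fun _ => rfl) t
    rw [(mem_cotensorOp_iff _).1 t.2] at h1
    exact h1
  obtain ⟨n', hn'⟩ := hX.exists_repr (fun m => ⟨h (μ.unit m), hco m⟩)
    (fun m m' => Subtype.ext (by simp))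
    (fun r m => Subtype.ext (by simp [← μ.indHom_unit_left, hleft]))
  refine ⟨n', μ.ind_hom_ext hA (Algebra.lmul k A) (pairHom_left hA X μ n') hleft fun m => ?_⟩
  rw [pairHom_unit, hn']

/-- The action `ν` on `N₁` is the one induced by `B ⊗ Aᵒᵖ` acting on `Hom(F(M₁), A) ⊇ N₁`. -/
def DualCompatible : Prop :=
  ∀ (t : cotensorOp k H B A) (n : N₁),
    pairHom hA X μ (ν.act t n) = homAct μ.indHom (t : B ⊗[k] Aᵐᵒᵖ) (pairHom hA X μ n)

variable {X} in
theorem exists_dualCompatible (hX : X.IsStrict) : ∃ ν, DualCompatible hA X μ ν := by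
  let Γ : cotensorOp k H B A →ₐ[k] Module.End k (μ.Ind →ₗ[k] A) :=
    (homAct μ.indHom).comp (cotensorOp k H B A).val
  obtain ⟨act, hact⟩ := exists_act_of_injective Γ
    (pairHom_injective hA μ hX) (fun t n => exists_homAct_pairHom hA μ hX t n)
  refine ⟨⟨act, fun b a n => pairHom_injective hA μ hX ?_⟩, hact⟩
  refine LinearMap.ext fun z => ?_
  rw [hact, pairHom_smul_left, pairHom_smul_right]
  exact homAct_tmul _ _ _ _ _

variable {hA X μ} in
theorem DualCompatible.unique {ν ν' : BoxModule k H B A N₁} (hX : X.IsStrict)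
    (hν : DualCompatible hA X μ ν) (hν' : DualCompatible hA X μ ν') : ν = ν' := by
  ext t n
  apply pairHom_injective hA μ hX
  rw [hν, hν']

variable {hA X μ ν}

theorem indPair_balanced (hν : DualCompatible hA X μ ν) (t : cotensorOp k H B A)
    (x : B ⊗[k] Aᵐᵒᵖ) (n : N₁) :
    (homAct μ.indHom).toLinearMap.compl₂ (pairHom hA X μ)
      (LinearMap.mulRight k (t : B ⊗[k] Aᵐᵒᵖ) x) n =
    (homAct μ.indHom).toLinearMap.compl₂ (pairHom hA X μ) x (ν.act t n) := by
  simp [hν t n]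

/-- The pairing `F(N₁) × F(M₁) → A` that extends `α`. -/
def indPair (hν : DualCompatible hA X μ ν) : ν.Ind →ₗ[k] μ.Ind →ₗ[k] A :=
  BalTensor.lift ((homAct μ.indHom).toLinearMap.compl₂ (pairHom hA X μ)) (indPair_balanced hν)

theorem indPair_tmul (hν : DualCompatible hA X μ ν) (x : B ⊗[k] Aᵐᵒᵖ) (n : N₁) :
    indPair hν (BalTensor.tmul _ _ x n) = homAct μ.indHom x (pairHom hA X μ n) :=
  BalTensor.lift_tmul _ _ _ _

theorem indPair_unit (hν : DualCompatible hA X μ ν) (n : N₁) :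
    indPair hν (ν.unit n) = pairHom hA X μ n := by
  have h := indPair_tmul hν 1 n
  rw [ν.tmul_eq] at h
  simpa using h

theorem indPair_indHom (hν : DualCompatible hA X μ ν) (x : B ⊗[k] Aᵐᵒᵖ) (y : ν.Ind) :
    indPair hν (ν.indHom x y) = homAct μ.indHom x (indPair hν y) := by
  induction y using BalTensor.induction with
  | zero => simp
  | add y z hy hz => simp only [map_add, hy, hz]
  | tmul y m =>
    rw [indPair_tmul, ← Module.End.mul_apply, ← map_mul, ← indPair_tmul hν, ν.tmul_eq, ν.tmul_eq,
      ← Module.End.mul_apply, ← map_mul]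

theorem indPair_left (hν : DualCompatible hA X μ ν) (y : ν.Ind) (a : A) (z : μ.Ind) :
    indPair hν y (μ.indHom (a ⊗ₜ 1) z) = a * indPair hν y z := by
  induction y using BalTensor.induction with
  | zero => simp
  | add x y hx hy => simp only [map_add, LinearMap.add_apply, hx, hy, mul_add]
  | tmul x n =>
    rw [indPair_tmul]
    exact homAct_left (pairHom_left hA X μ n) x a z

theorem indPair_mid (hν : DualCompatible hA X μ ν) (b : B) (y : ν.Ind) (z : μ.Ind) :
    indPair hν (ν.indHom (b ⊗ₜ 1) y) z =
      indPair hν y (μ.indHom (1 ⊗ₜ MulOpposite.op b) z) := by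
  rw [indPair_indHom, homAct_tmul]
  simp

theorem indPair_right (hν : DualCompatible hA X μ ν) (a : Aᵐᵒᵖ) (y : ν.Ind) (z : μ.Ind) :
    indPair hν (ν.indHom (1 ⊗ₜ a) y) z = indPair hν y z * a.unop := by
  rw [indPair_indHom, homAct_tmul, MulOpposite.op_one, ← Algebra.TensorProduct.one_def, map_one,
    Module.End.one_apply]

/-- `f_n(z) m = z β(n ⊗ m)` in `F(M₁)`. -/
theorem indHom_pairHom_unit (n : N₁) (z : μ.Ind) (m : M₁) :
    μ.indHom (pairHom hA X μ n z ⊗ₜ 1) (μ.unit m) =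
      μ.indHom (1 ⊗ₜ MulOpposite.op (X.swap.pair n m : B)) z := by
  induction z using μ.ind_induction hA with
  | add x y hx hy => simp only [map_add, TensorProduct.add_tmul, LinearMap.add_apply, hx, hy]
  | unit a m' =>
    have h1 : μ.indHom (1 ⊗ₜ MulOpposite.op (X.swap.pair n m : B))
        (μ.indHom (a ⊗ₜ 1) (μ.unit m')) = μ.indHom (a ⊗ₜ 1)
        (μ.indHom (1 ⊗ₜ MulOpposite.op (X.swap.pair n m : B)) (μ.unit m')) := by
      rw [← Module.End.mul_apply, ← Module.End.mul_apply, ← map_mul, ← map_mul]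
      simp
    have h2 : (a * (X.pair m' n : A)) ⊗ₜ[k] (1 : Bᵐᵒᵖ) =
        (a ⊗ₜ 1) * ((X.pair m' n : A) ⊗ₜ 1) := by simp
    rw [h1, μ.indHom_unit_right, ← X.pair_smul, ← μ.indHom_unit_left, pairHom_left, pairHom_unit,
      h2, map_mul, Module.End.mul_apply]

/-- The associativity `[x, y] m = x [y, m]` between the pairing `F(N₁) × F(M₁) → A` and the maps
`F(N₁) → B` defined by elements of `M₁`. -/
theorem indHom_indPair_unit (hB : IsRightFaithfullyFlatGalois k H B)
    (hν : DualCompatible hA X μ ν) (y : ν.Ind) (z : μ.Ind) (m : M₁) :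
    μ.indHom (indPair hν y z ⊗ₜ 1) (μ.unit m) =
      μ.indHom (1 ⊗ₜ MulOpposite.op (pairHom hB X.swap ν m y)) z := by
  induction y using ν.ind_induction hB with
  | add x y hx hy =>
    simp only [map_add, TensorProduct.add_tmul, TensorProduct.tmul_add, LinearMap.add_apply,
      MulOpposite.op_add, hx, hy]
  | unit b n =>
    have h1 : (1 : A) ⊗ₜ[k] MulOpposite.op (b * (X.swap.pair n m : B)) =
        (1 ⊗ₜ MulOpposite.op (X.swap.pair n m : B)) * (1 ⊗ₜ MulOpposite.op b) := by simp
    rw [indPair_mid, indPair_unit, indHom_pairHom_unit, pairHom_left, pairHom_unit, h1, map_mul,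
      Module.End.mul_apply]

/-- The right action of `B` on `F(M₁)` is faithful. The annihilator of `F(M₁)` is a left ideal and a
subcomodule of `B`, hence generated by its coinvariants, and `B^{co H}` acts faithfully on `M₁`. -/
theorem eq_zero_of_indHom_right [Module.Projective k H] (hA : IsRightFaithfullyFlatGalois k H A)
    (hB : IsRightFaithfullyFlatGalois k H B) (hX : X.IsStrict) {b : B}
    (hb : ∀ z, μ.indHom (1 ⊗ₜ MulOpposite.op b) z = 0) : b = 0 := by
  let θ : B →ₗ[k] Module.End k μ.Ind :=
    (rightPart μ.indHom).toLinearMap ∘ₗ (MulOpposite.opLinearEquiv k).toLinearMap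
  have hθ (b c : B) : θ (Algebra.lmul k B b c) =
      precompAct μ.Ind (rightPart μ.indHom) b (θ c) := by
    ext z
    simp [θ]
  have hv : θ.rTensor H (coact k H B b) = 0 := by
    refine eq_zero_of_forall_dual fun p => ?_
    have h1 (q : B ⊗[k] H) : TensorProduct.rid k _ (p.lTensor _ (θ.rTensor H q)) =
        θ (TensorProduct.rid k _ (p.lTensor _ q)) := by
      induction q with
      | zero => simp
      | add x y hx hy => simp only [map_add, hx, hy]
      | tmul b h => simp
    have h2 (q : B ⊗[k] H) (v : μ.Ind) : θ (TensorProduct.rid k _ (p.lTensor _ q)) v =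
        TensorProduct.rid k _ (p.lTensor _
          (ractH H (rightPart μ.indHom) (MulOpposite.op q) (v ⊗ₜ 1))) := by
      induction q with
      | zero => simp
      | add x y hx hy => simp only [map_add, LinearMap.add_apply, MulOpposite.op_add, hx, hy]
      | tmul b h => simp [θ]
    rw [h1]
    refine LinearMap.ext fun z => ?_
    induction z using μ.ind_induction hA with
    | add x y hx hy => simp only [map_add, hx, hy]
    | unit a m =>
      have h3 : θ (TensorProduct.rid k _ (p.lTensor _ (coact k H B b))) (μ.unit m) = 0 := by
        have h4 := μ.indCoact_indHom (1 ⊗ₜ MulOpposite.op b) (μ.unit m)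
        rw [hb, map_zero, μ.indCoact_unit, biDiag_tmul, map_one, Module.End.one_apply,
          rdiagAct_op] at h4
        rw [h2, ← h4, map_zero, map_zero]
      have h5 := LinearMap.congr_fun (leftPart_rightPart_commute μ.indHom a (MulOpposite.op
        (TensorProduct.rid k _ (p.lTensor _ (coact k H B b))))) (μ.unit m)
      refine h5.symm.trans ?_
      rw [Module.End.mul_apply]
      erw [h3]
      simp
  have hmem := exists_coinv_preimage (ρ := (coact k H B).toLinearMap) hB ComoduleAlgebra.coassoc
    ComoduleAlgebra.counit (fun b c => by simp [diagAct_apply, actH_lmul]) hθ hv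
  have hle : Submodule.span k {x | ∃ a, ∃ c ∈ coinvSub (coact k H B).toLinearMap,
      θ c = 0 ∧ x = Algebra.lmul k B a c} ≤ ⊥ := by
    refine Submodule.span_le.2 ?_
    rintro _ ⟨a, c, hc, hθc, rfl⟩
    have hc' : c ∈ coinv k H B := mem_coinvSub.1 hc
    have h6 : (⟨c, hc'⟩ : coinv k H B) = 0 := by
      obtain ⟨ι, _, n, m, h1⟩ := MoritaContext.exists_sum_pair_eq_one hX.swap.1.2
      rw [← one_mul (⟨c, hc'⟩ : coinv k H B), ← h1, Finset.sum_mul]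
      refine Finset.sum_eq_zero fun i _ => ?_
      rw [← MoritaContext.pair_smul_right]
      have h7 : MulOpposite.op (⟨c, hc'⟩ : coinv k H B) • m i = 0 := by
        refine hX.eq_zero_left fun n => Subtype.val_injective ?_
        rw [← pairHom_unit hA X μ, ← μ.indHom_unit_right]
        have := LinearMap.congr_fun hθc (μ.unit (m i))
        change μ.indHom (1 ⊗ₜ MulOpposite.op c) (μ.unit (m i)) = 0 at this
        rw [this]
        simp
      rw [h7, map_zero]
    have h8 : c = 0 := congrArg Subtype.val h6
    simp [h8]
  simpa using hle hmem

/-- If the action on `N₁` is induced by that on `M₁`, then the action on `M₁` is induced by that on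
`N₁`. The two sides of the equation to be proved are elements of `B`, which are compared by their
right action on `F(M₁)`. -/
theorem DualCompatible.swap [Module.Projective k H] (hX : X.IsStrict)
    (hν : DualCompatible hA X μ ν) (hB : IsRightFaithfullyFlatGalois k H B) :
    DualCompatible hB X.swap ν μ := by
  intro t m
  refine LinearMap.ext fun y => ?_
  rw [← sub_eq_zero]
  refine eq_zero_of_indHom_right (μ := μ) hA hB hX fun z => ?_
  have key (x : A ⊗[k] Bᵐᵒᵖ) :
      μ.indHom (1 ⊗ₜ MulOpposite.op (homAct ν.indHom x (pairHom hB X.swap ν m) y)) z =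
        μ.indHom (indPair hν y z ⊗ₜ 1) (μ.indHom x (μ.unit m)) := by
    induction x with
    | zero => simp
    | add x x' hx hx' =>
      simp only [map_add, LinearMap.add_apply, MulOpposite.op_add, TensorProduct.tmul_add, hx, hx']
    | tmul a b =>
      have h1 (c : B) : (1 : A) ⊗ₜ[k] MulOpposite.op (c * b.unop) =
          (1 ⊗ₜ b) * (1 ⊗ₜ MulOpposite.op c) := by simp
      rw [homAct_tmul, h1, map_mul, Module.End.mul_apply, ← indHom_indPair_unit hB hν,
        indPair_right, ← Module.End.mul_apply, ← Module.End.mul_apply, ← map_mul, ← map_mul]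
      simp
  rw [MulOpposite.op_sub, TensorProduct.tmul_sub, map_sub, LinearMap.sub_apply, key,
    ← indHom_indPair_unit hB hν, μ.indHom_unit, sub_self]

end Pairing

/-! ### Coactions on induced modules -/

section DiagonalCoaction

variable {k H A B V W : Type*} [CommRing k] [Ring H] [HopfAlgebra k H] [Ring A] [Algebra k A]
  [Ring B] [Algebra k B] [AddCommGroup V] [Module k V] [AddCommGroup W] [Module k W]

theorem rTensor_lift_diagCoact {L : A →ₐ[k] Module.End k V} {R : Bᵐᵒᵖ →ₐ[k] Module.End k V}
    {L' : B →ₐ[k] Module.End k W} {e : V →ₗ[k] W →ₗ[k] A} {f : V →ₗ[k] A} {v v' : V} {w w' : W}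
    {ρ : V →ₗ[k] V ⊗[k] H} {σ : W →ₗ[k] W ⊗[k] H} {p : A ⊗[k] H} {q : B ⊗[k] H}
    (h : ∀ a b, e (L a v) (L' b w) = a * f (R (MulOpposite.op b) v))
    (hv : ρ v' = actH H L p (v ⊗ₜ 1)) (hw : σ w' = actH H L' q (w ⊗ₜ 1)) :
    (TensorProduct.lift e).rTensor H (diagCoact ρ σ (v' ⊗ₜ w')) =
      p * f.rTensor H (ractH H R (MulOpposite.op q) (v ⊗ₜ 1)) := by
  rw [diagCoact, LinearMap.comp_apply, LinearMap.comp_apply, TensorProduct.map_tmul, hv, hw]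
  clear hv hw
  induction p with
  | zero => simp
  | add p p' hp hp' =>
    simp only [map_add, LinearMap.add_apply, TensorProduct.add_tmul, add_mul, hp, hp']
  | tmul a g =>
    induction q with
    | zero => simp
    | add p p' hp hp' =>
      simp only [map_add, LinearMap.add_apply, TensorProduct.tmul_add, mul_add,
        MulOpposite.op_add, hp, hp']
    | tmul b g' => simp [h]

theorem leftMulH_eq_actH [Module A V] [IsScalarTower k A V]
    (p : A ⊗[k] H) (z : V ⊗[k] H) :
    leftMulH k H A V p z = actH H (Algebra.lsmul k k V) p z := by
  induction p with
  | zero => simp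
  | add p q hp hq => simp only [map_add, LinearMap.add_apply, hp, hq]
  | tmul a h =>
    induction z with
    | zero => simp
    | add p q hp hq => simp only [map_add, hp, hq]
    | tmul v g => simp [leftMulH]

theorem rightMulH_eq_ractH [Module Bᵐᵒᵖ V] [IsScalarTower k Bᵐᵒᵖ V]
    (p : B ⊗[k] H) (z : V ⊗[k] H) :
    rightMulH k H B V p z = ractH H (Algebra.lsmul k k V) (MulOpposite.op p) z := by
  induction p with
  | zero => simp
  | add p q hp hq => simp only [map_add, MulOpposite.op_add, LinearMap.add_apply, hp, hq]
  | tmul a h =>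
    induction z with
    | zero => simp
    | add p q hp hq => simp only [map_add, hp, hq]
    | tmul v g => simp [rightMulH]

end DiagonalCoaction

section IndModule

variable {k H A B M₁ : Type*} [CommRing k] [Ring H] [HopfAlgebra k H]
  [BijectiveAntipode k H] [Ring A] [Algebra k A] [ComoduleAlgebra k H A]
  [Ring B] [Algebra k B] [ComoduleAlgebra k H B]
  [AddCommGroup M₁] [Module k M₁] [Module (coinv k H A) M₁] [Module (coinv k H B)ᵐᵒᵖ M₁]

/-- `F(M₁)` as a left `A`-module. -/
abbrev BoxModule.leftModule (μ : BoxModule k H A B M₁) : Module A μ.Ind :=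
  Module.compHom μ.Ind (leftPart μ.indHom).toRingHom

/-- `F(M₁)` as a right `B`-module. -/
abbrev BoxModule.rightModule (μ : BoxModule k H A B M₁) : Module Bᵐᵒᵖ μ.Ind :=
  Module.compHom μ.Ind (rightPart μ.indHom).toRingHom

theorem BoxModule.leftModule_isScalarTower (μ : BoxModule k H A B M₁) :
    let _ := μ.leftModule
    IsScalarTower k A μ.Ind :=
  let _ := μ.leftModule
  ⟨fun c a z => by
    change leftPart μ.indHom (c • a) z = c • leftPart μ.indHom a z
    simp⟩

theorem BoxModule.rightModule_isScalarTower (μ : BoxModule k H A B M₁) :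
    let _ := μ.rightModule
    IsScalarTower k Bᵐᵒᵖ μ.Ind :=
  let _ := μ.rightModule
  ⟨fun c b z => by
    change rightPart μ.indHom (c • b) z = c • rightPart μ.indHom b z
    simp⟩

theorem BoxModule.smulCommClass (μ : BoxModule k H A B M₁) :
    let _ := μ.leftModule
    let _ := μ.rightModule
    SMulCommClass A Bᵐᵒᵖ μ.Ind :=
  let _ := μ.leftModule
  let _ := μ.rightModule
  ⟨fun a b z => LinearMap.congr_fun (leftPart_rightPart_commute μ.indHom a b) z⟩

/-- `F(M₁)` as an object of `_A M_B^H`. -/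
abbrev BoxModule.relHopfBimodule (μ : BoxModule k H A B M₁) :
    let _ := μ.leftModule
    let _ := μ.rightModule
    have _ := μ.leftModule_isScalarTower
    have _ := μ.rightModule_isScalarTower
    have _ := μ.smulCommClass
    RelHopfBimodule k H A B μ.Ind :=
  letI := μ.leftModule
  letI := μ.rightModule
  haveI := μ.leftModule_isScalarTower
  haveI := μ.rightModule_isScalarTower
  haveI := μ.smulCommClass
  { coact := μ.indCoact
    coassoc := μ.indCoact_coassoc
    counit := μ.indCoact_counit
    coact_left := fun a z => by
      rw [leftMulH_eq_actH]
      exact μ.indCoact_left a z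
    coact_right := fun b z => by
      rw [rightMulH_eq_ractH]
      exact μ.indCoact_right b z }

end IndModule

/-! ### The induced Morita context -/

section Induced

variable {k H A B M₁ N₁ : Type u} [CommRing k] [Ring H] [HopfAlgebra k H]
  [BijectiveAntipode k H]
  [Ring A] [Algebra k A] [ComoduleAlgebra k H A]
  [Ring B] [Algebra k B] [ComoduleAlgebra k H B]
  [AddCommGroup M₁] [Module k M₁]
  [Module (coinv k H A) M₁] [IsScalarTower k (coinv k H A) M₁]
  [Module (coinv k H B)ᵐᵒᵖ M₁] [IsScalarTower k (coinv k H B)ᵐᵒᵖ M₁]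
  [SMulCommClass (coinv k H A) (coinv k H B)ᵐᵒᵖ M₁]
  [AddCommGroup N₁] [Module k N₁]
  [Module (coinv k H B) N₁] [IsScalarTower k (coinv k H B) N₁]
  [Module (coinv k H A)ᵐᵒᵖ N₁] [IsScalarTower k (coinv k H A)ᵐᵒᵖ N₁]
  [SMulCommClass (coinv k H B) (coinv k H A)ᵐᵒᵖ N₁]
  {hA : IsRightFaithfullyFlatGalois k H A} {hB : IsRightFaithfullyFlatGalois k H B}
  {X : MoritaContext k (coinv k H A) (coinv k H B) M₁ N₁} {μ : BoxModule k H A B M₁}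
  {ν : BoxModule k H B A N₁}

/-- The associativity condition of a Morita context for the induced pairings. -/
theorem indHom_indPair (hν : DualCompatible hA X μ ν) (hμ : DualCompatible hB X.swap ν μ)
    (y : ν.Ind) (z z' : μ.Ind) :
    μ.indHom (indPair hν y z ⊗ₜ 1) z' = μ.indHom (1 ⊗ₜ MulOpposite.op (indPair hμ z' y)) z := by
  induction z' using μ.ind_induction hA with
  | add z w hz hw =>
    simp only [map_add, LinearMap.add_apply, MulOpposite.op_add, TensorProduct.tmul_add, hz, hw]
  | unit a m =>
    rw [indPair_mid, indPair_unit, ← indHom_indPair_unit hB hν, indPair_right,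
      ← Module.End.mul_apply, ← map_mul]
    simp

section Families

variable {ρ : B → Module.End k μ.Ind} {l : B → Module.End k ν.Ind}

theorem indPair_flip_balanced (hν : DualCompatible hA X μ ν)
    (hρ : ∀ b z, ρ b z = μ.indHom (1 ⊗ₜ MulOpposite.op b) z)
    (hl : ∀ b z, l b z = ν.indHom (b ⊗ₜ 1) z) (b : B) (z : μ.Ind) (y : ν.Ind) :
    (indPair hν).flip (ρ b z) y = (indPair hν).flip z (l b y) := by
  rw [LinearMap.flip_apply, LinearMap.flip_apply, hρ, hl, indPair_mid]

/-- The map `F(M₁) ⊗_B F(N₁) → A` that extends `α`. The actions of `B` are arbitrary families of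
maps that agree with those of the bimodules, to cover the different ways to write them. -/
def indAlpha (hν : DualCompatible hA X μ ν)
    (hρ : ∀ b z, ρ b z = μ.indHom (1 ⊗ₜ MulOpposite.op b) z)
    (hl : ∀ b z, l b z = ν.indHom (b ⊗ₜ 1) z) : BalTensor k ρ l →ₗ[k] A :=
  BalTensor.lift (indPair hν).flip (indPair_flip_balanced hν hρ hl)

@[simp]
theorem indAlpha_tmul (hν : DualCompatible hA X μ ν)
    (hρ : ∀ b z, ρ b z = μ.indHom (1 ⊗ₜ MulOpposite.op b) z)
    (hl : ∀ b z, l b z = ν.indHom (b ⊗ₜ 1) z) (z : μ.Ind) (y : ν.Ind) :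
    indAlpha hν hρ hl (BalTensor.tmul ρ l z y) = indPair hν y z :=
  BalTensor.lift_tmul _ _ _ _

theorem exists_sum_indPair_eq_one (hX : X.IsStrict) (hν : DualCompatible hA X μ ν) :
    ∃ (ι : Type) (_ : Fintype ι) (z : ι → μ.Ind) (y : ι → ν.Ind),
      ∑ i, indPair hν (y i) (z i) = 1 := by
  obtain ⟨ι, _, m, n, h1⟩ := MoritaContext.exists_sum_pair_eq_one hX.1.2
  refine ⟨ι, inferInstance, fun i => μ.unit (m i), fun i => ν.unit (n i), ?_⟩
  simp only [indPair_unit, pairHom_unit]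
  simpa using congrArg Subtype.val h1

/-- The usual argument that a surjective connecting map of a Morita context is injective:
`z ⊗ y = ∑ z ⊗ y [zᵢ, yᵢ] = ∑ z ⊗ [y, zᵢ] yᵢ = ∑ z [y, zᵢ] ⊗ yᵢ = ∑ [z, y] zᵢ ⊗ yᵢ`
if `∑ [zᵢ, yᵢ] = 1`. -/
theorem indAlpha_bijective (hX : X.IsStrict) (hν : DualCompatible hA X μ ν)
    (hμ : DualCompatible hB X.swap ν μ)
    (hρ : ∀ b z, ρ b z = μ.indHom (1 ⊗ₜ MulOpposite.op b) z)
    (hl : ∀ b z, l b z = ν.indHom (b ⊗ₜ 1) z) : Function.Bijective (indAlpha hν hρ hl) := by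
  obtain ⟨ι, _, z, y, h1⟩ := exists_sum_indPair_eq_one hX hν
  constructor
  · have key (w : BalTensor k ρ l) :
        w = ∑ i, BalTensor.mk ρ l (μ.indHom (indAlpha hν hρ hl w ⊗ₜ 1) (z i)) (y i) := by
      induction w using BalTensor.induction with
      | zero => simp
      | add w w' hw hw' =>
        conv_lhs => rw [hw, hw']
        simp only [map_add, TensorProduct.add_tmul, LinearMap.add_apply, Finset.sum_add_distrib]
      | tmul u v =>
        have h2 : v = ∑ i, ν.indHom (indPair hμ (z i) v ⊗ₜ 1) (y i) := by
          have h3 (i : ι) : ν.indHom (indPair hμ (z i) v ⊗ₜ 1) (y i) =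
              ν.indHom (1 ⊗ₜ MulOpposite.op (indPair hν (y i) (z i))) v :=
            indHom_indPair (X := X.swap) hμ hν (z i) v (y i)
          simp only [h3]
          rw [← LinearMap.sum_apply, ← map_sum, ← TensorProduct.tmul_sum, ← Finset.op_sum, h1]
          simp [← Algebra.TensorProduct.one_def]
        conv_lhs => rw [h2, ← BalTensor.mk_apply, map_sum]
        refine Finset.sum_congr rfl fun i _ => ?_
        rw [BalTensor.mk_apply, BalTensor.mk_apply, ← hl, ← BalTensor.smul_tmul, hρ,
          ← indHom_indPair hν hμ, indAlpha_tmul]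
    refine (injective_iff_map_eq_zero _).2 fun w hw => ?_
    rw [key w, hw]
    simp
  · intro a
    refine ⟨∑ i, BalTensor.tmul _ _ (μ.indHom (a ⊗ₜ 1) (z i)) (y i), ?_⟩
    simp only [map_sum, indAlpha_tmul, indPair_left]
    rw [← Finset.mul_sum, h1, mul_one]

end Families

set_option maxHeartbeats 400000 in
/-- The pairing `F(M₁) ⊗ F(N₁) → A` is colinear for the diagonal coaction. -/
theorem coact_indPair (hB : IsRightFaithfullyFlatGalois k H B) (hν : DualCompatible hA X μ ν)
    (x : μ.Ind ⊗[k] ν.Ind) :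
    coact k H A (TensorProduct.lift (indPair hν).flip x) =
      (TensorProduct.lift (indPair hν).flip).rTensor H (diagCoact μ.indCoact ν.indCoact x) := by
  induction x with
  | zero => simp
  | add x y hx hy => simp only [map_add, hx, hy]
  | tmul z y =>
    induction z using μ.ind_induction hA with
    | add z w hz hw => simp only [map_add, TensorProduct.add_tmul, hz, hw]
    | unit a m =>
      induction y using ν.ind_induction hB with
      | add z w hz hw => simp only [map_add, TensorProduct.tmul_add, hz, hw]
      | unit b n =>
        have h (a : A) (b : B) : (indPair hν).flip (leftPart μ.indHom a (μ.unit m))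
            (leftPart ν.indHom b (ν.unit n)) =
            a * pairHom hA X μ n (rightPart μ.indHom (MulOpposite.op b) (μ.unit m)) := by
          rw [LinearMap.flip_apply, leftPart_apply, leftPart_apply, indPair_left, indPair_mid,
            indPair_unit, rightPart_apply]
        have h1 := h a b
        rw [leftPart_apply, leftPart_apply] at h1
        rw [TensorProduct.lift.tmul, h1, map_mul, coact_pairHom, rightPart_apply, μ.indCoact_right,
          μ.indCoact_unit]
        refine (rTensor_lift_diagCoact h (p := coact k H A a) (q := coact k H B b) ?_ ?_).symm
        · rw [μ.indCoact_left, μ.indCoact_unit]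
        · rw [ν.indCoact_left, ν.indCoact_unit]

/-- The modules `F(M₁)` and `F(N₁)` with the pairings that extend `α` and `β` form a strict
`H`-Morita context. -/
theorem hMoritaEquivalent_of_dualCompatible (hX : X.IsStrict) (hν : DualCompatible hA X μ ν)
    (hμ : DualCompatible hB X.swap ν μ) : HMoritaEquivalent k H A B := by
  let _ := μ.leftModule
  let _ := μ.rightModule
  have _ := μ.leftModule_isScalarTower
  have _ := μ.rightModule_isScalarTower
  have _ := μ.smulCommClass
  let _ := ν.leftModule
  let _ := ν.rightModule
  have _ := ν.leftModule_isScalarTower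
  have _ := ν.rightModule_isScalarTower
  have _ := ν.smulCommClass
  let _ := μ.relHopfBimodule
  let _ := ν.relHopfBimodule
  let Y : MoritaContext k A B μ.Ind ν.Ind :=
    { α := indAlpha hν (fun _ _ => rfl) (fun _ _ => rfl)
      β := indAlpha hμ (fun _ _ => rfl) (fun _ _ => rfl)
      α_left := fun a z y => indPair_left hν y a z
      α_right := fun a z y => indPair_right hν (MulOpposite.op a) y z
      β_left := fun b y z => indPair_left hμ z b y
      β_right := fun b y z => indPair_right hμ (MulOpposite.op b) z y
      α_β := fun z y z' => indHom_indPair hν hμ y z z'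
      β_α := fun y z y' => indHom_indPair (X := X.swap) hμ hν z y y' }
  refine ⟨μ.Ind, ν.Ind, inferInstance, inferInstance, inferInstance, inferInstance, inferInstance,
    inferInstance, inferInstance, inferInstance, inferInstance, inferInstance, inferInstance,
    inferInstance, inferInstance, inferInstance, inferInstance, inferInstance, Y, ⟨?_, ?_⟩, ?_, ?_⟩
  · exact coact_indPair hB hν
  · exact coact_indPair hA hμ
  · exact indAlpha_bijective hX hν hμ (fun _ _ => rfl) (fun _ _ => rfl)
  · exact indAlpha_bijective hX.swap hμ hν (fun _ _ => rfl) (fun _ _ => rfl)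

end Induced

/-! ### Linearity over the cotensor product -/

section IndTensorAct

variable {k H A B M₁ N₁ : Type*} [CommRing k] [Ring H] [HopfAlgebra k H]
  [BijectiveAntipode k H] [Ring A] [Algebra k A] [ComoduleAlgebra k H A]
  [Ring B] [Algebra k B] [ComoduleAlgebra k H B]
  [AddCommGroup M₁] [Module k M₁] [Module (coinv k H A) M₁] [Module (coinv k H B)ᵐᵒᵖ M₁]
  [AddCommGroup N₁] [Module k N₁] [Module (coinv k H B) N₁] [Module (coinv k H A)ᵐᵒᵖ N₁]
  {μ : BoxModule k H A B M₁} {ν : BoxModule k H B A N₁}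

theorem indTensorAct_tmul (a : A) (c : Aᵐᵒᵖ) (z : μ.Ind) (y : ν.Ind) :
    indTensorAct μ ν (a ⊗ₜ c) (BalTensor.tmul _ _ z y) =
      BalTensor.tmul _ _ (μ.indHom (a ⊗ₜ 1) z) (ν.indHom (1 ⊗ₜ c) y) := rfl

theorem indTensorAct_add (x x' : A ⊗[k] Aᵐᵒᵖ) (w : IndTensor μ ν) : indTensorAct μ ν (x + x') w =
    indTensorAct μ ν x w + indTensorAct μ ν x' w := by
  induction w using BalTensor.induction with
  | zero => simp
  | add y z hy hz => rw [map_add, map_add, map_add, hy, hz, add_add_add_comm]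
  | tmul z y =>
    simp only [indTensorAct, BalTensor.tmul, Submodule.mkQ_apply, Submodule.mapQ_apply, map_add,
      LinearMap.add_apply, Submodule.Quotient.mk_add]

theorem indTensorAct_zero (w : IndTensor μ ν) : indTensorAct μ ν 0 w = 0 := by
  simpa using indTensorAct_add 0 0 w

set_option maxHeartbeats 1000000 in
theorem indTensorAct_mul (a : A) (x : A ⊗[k] Aᵐᵒᵖ) (w : IndTensor μ ν) :
    indTensorAct μ ν (a ⊗ₜ 1 * x) w = indTensorAct μ ν (a ⊗ₜ 1) (indTensorAct μ ν x w) := by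
  induction x with
  | zero => rw [mul_zero, indTensorAct_zero, map_zero]
  | add x x' hx hx' =>
    rw [mul_add, indTensorAct_add, indTensorAct_add x x']
    exact (congrArg₂ (· + ·) hx hx').trans (map_add (indTensorAct μ ν (a ⊗ₜ 1)) _ _).symm
  | tmul b c =>
    induction w using BalTensor.induction with
    | zero => simp
    | add y z hy hz => rw [map_add, map_add, map_add, hy, hz]
    | tmul z y =>
      rw [Algebra.TensorProduct.tmul_mul_tmul, indTensorAct_tmul, indTensorAct_tmul,
        indTensorAct_tmul, ← μ.indHom_mul, ← ν.indHom_mul, Algebra.TensorProduct.tmul_mul_tmul,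
        Algebra.TensorProduct.tmul_mul_tmul, one_mul, one_mul, mul_one]

theorem unitTensor_tmul [IsScalarTower k (coinv k H B)ᵐᵒᵖ M₁] [IsScalarTower k (coinv k H B) N₁]
    (m : M₁) (n : N₁) :
    unitTensor μ ν (tmulOver k (coinv k H B) m n) = BalTensor.tmul _ _ (μ.unit m) (ν.unit n) := rfl

end IndTensorAct

section BoxLinear

variable {k H A B M₁ N₁ : Type u} [CommRing k] [Ring H] [HopfAlgebra k H]
  [BijectiveAntipode k H]
  [Ring A] [Algebra k A] [ComoduleAlgebra k H A]
  [Ring B] [Algebra k B] [ComoduleAlgebra k H B]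
  [AddCommGroup M₁] [Module k M₁]
  [Module (coinv k H A) M₁] [IsScalarTower k (coinv k H A) M₁]
  [Module (coinv k H B)ᵐᵒᵖ M₁] [IsScalarTower k (coinv k H B)ᵐᵒᵖ M₁]
  [SMulCommClass (coinv k H A) (coinv k H B)ᵐᵒᵖ M₁]
  [AddCommGroup N₁] [Module k N₁]
  [Module (coinv k H B) N₁] [IsScalarTower k (coinv k H B) N₁]
  [Module (coinv k H A)ᵐᵒᵖ N₁] [IsScalarTower k (coinv k H A)ᵐᵒᵖ N₁]
  [SMulCommClass (coinv k H B) (coinv k H A)ᵐᵒᵖ N₁]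
  {hA : IsRightFaithfullyFlatGalois k H A} {hB : IsRightFaithfullyFlatGalois k H B}
  {X : MoritaContext k (coinv k H A) (coinv k H B) M₁ N₁} {μ : BoxModule k H A B M₁}
  {ν : BoxModule k H B A N₁}

omit [BijectiveAntipode k H] in
theorem coact_mulLeftRight (c : coinv k H A) (Ω : A ⊗[k] Aᵐᵒᵖ →ₗ[k] A)
    (hΩ : ∀ x, Ω x = AlgHom.mulLeftRight k A x c) (x : A ⊗[k] Aᵐᵒᵖ) :
    coact k H A (Ω x) = Ω.rTensor H (enveloCoact k H A A x) := by
  induction x with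
  | zero => simp
  | add x y hx hy => simp only [map_add, hx, hy]
  | tmul b a =>
    induction a with | h a =>
    rw [hΩ, AlgHom.mulLeftRight_apply, map_mul, map_mul, coact_coinv, enveloCoact_apply,
      biDiag_tmul, diagAct_apply, rdiagAct_op, MulOpposite.unop_op]
    generalize coact k H A a = q
    generalize coact k H A b = p
    induction q with
    | zero => simp
    | add q q' hq hq' =>
      simp only [map_add, MulOpposite.op_add, LinearMap.add_apply, mul_add, hq, hq']
    | tmul a g =>
      induction p with
      | zero => simp
      | add q q' hq hq' =>
        simp only [map_add, LinearMap.add_apply, add_mul, hq, hq']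
      | tmul b h =>
        simp [Algebra.TensorProduct.one_def, leftPart_apply, rightPart_apply, hΩ]

theorem mulLeftRight_mul (b : A) (x : A ⊗[k] Aᵐᵒᵖ) (c : A) :
    AlgHom.mulLeftRight k A (b ⊗ₜ 1 * x) c = b * AlgHom.mulLeftRight k A x c := by
  rw [map_mul, Module.End.mul_apply, AlgHom.mulLeftRight_apply, MulOpposite.unop_one, mul_one]

/-- `A^{co H}` is stable under the action of `A □_H Aᵒᵖ` on `A`. -/
theorem mulLeftRight_mem_coinv (t : cotensorOp k H A A) (c : coinv k H A) :
    AlgHom.mulLeftRight k A t c ∈ coinv k H A := by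
  have h1 := coact_mulLeftRight c ((AlgHom.mulLeftRight k A).toLinearMap.flip c) (fun _ => rfl) t
  rw [(mem_cotensorOp_iff _).1 t.2] at h1
  exact h1

set_option maxHeartbeats 400000 in
/-- The map `F(M₁) ⊗_B F(N₁) → A` that extends `α` is injective and `(A, A)`-bilinear; hence the
module structure of `F(M₁) ⊗_B F(N₁)` restricts to `M₁ ⊗ N₁`, and `α` is linear. -/
theorem isBoxLinear_of_dualCompatible (hX : X.IsStrict) (hν : DualCompatible hA X μ ν)
    (hμ : DualCompatible hB X.swap ν μ) : IsBoxLinear μ ν X.α := by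
  let E : IndTensor μ ν →ₗ[k] A := indAlpha hν (fun _ _ => rfl) (fun _ _ => rfl)
  have hE : Function.Injective E := (indAlpha_bijective hX hν hμ _ _).1
  have E_tmul (z : μ.Ind) (y : ν.Ind) : E (BalTensor.tmul _ _ z y) = indPair hν y z :=
    indAlpha_tmul _ _ _ _ _
  have E_unit (w) : E (unitTensor μ ν w) = X.α w := by
    induction w using BalTensor.induction with
    | zero => simp
    | add x y hx hy => simp only [map_add, Subalgebra.coe_add, hx, hy]
    | tmul m n =>
      rw [X.α_tmul, ← pairHom_unit hA X μ, ← indPair_unit hν, ← E_tmul]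
      rfl
  have E_act (x : A ⊗[k] Aᵐᵒᵖ) (w) : E (indTensorAct μ ν x w) = AlgHom.mulLeftRight k A x (E w) := by
    induction w using BalTensor.induction with
    | zero => simp
    | add x y hx hy => simp only [map_add, hx, hy]
    | tmul z y =>
      induction x with
      | zero => rw [indTensorAct_zero, map_zero, map_zero, LinearMap.zero_apply]
      | add x x' hx hx' =>
        rw [indTensorAct_add, map_add, hx, hx', map_add, LinearMap.add_apply]
      | tmul a c =>
        rw [indTensorAct_tmul, E_tmul, E_tmul, indPair_left, indPair_right,
          AlgHom.mulLeftRight_apply, mul_assoc]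
  let Γ : cotensorOp k H A A →ₐ[k] Module.End k A :=
    (AlgHom.mulLeftRight k A).comp (cotensorOp k H A A).val
  let f : TensorOver k (coinv k H B) M₁ N₁ →ₗ[k] A := (coinv k H A).val.toLinearMap ∘ₗ X.α
  have hf : Function.Injective f := Subtype.val_injective.comp hX.1.1
  have hΓ (t : cotensorOp k H A A) (w) : ∃ w', f w' = Γ t (f w) := by
    obtain ⟨w', hw'⟩ := hX.1.2 ⟨_, mulLeftRight_mem_coinv t (X.α w)⟩
    exact ⟨w', congrArg Subtype.val hw'⟩
  obtain ⟨τ, hτ⟩ := exists_act_of_injective (T := cotensorOp k H A A) (W := A)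
    (N := TensorOver k (coinv k H B) M₁ N₁) Γ hf hΓ
  refine ⟨τ, ⟨fun w w' h => hf ?_, fun t w => hE ?_⟩, hτ⟩
  · change (X.α w : A) = X.α w'
    rw [← E_unit, ← E_unit, h]
  · rw [E_act, E_unit, E_unit]
    exact hτ t w

theorem exists_ind_lift_pairHom (hA : IsRightFaithfullyFlatGalois k H A)
    (hB : IsRightFaithfullyFlatGalois k H B)
    (X : MoritaContext k (coinv k H A) (coinv k H B) M₁ N₁) (μ : BoxModule k H A B M₁)
    (ν : BoxModule k H B A N₁) :
    ∃ e : ν.Ind →ₗ[k] μ.Ind →ₗ[k] A,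
      (∀ b y z, e (ν.indHom (b ⊗ₜ 1) y) z = e y (μ.indHom (1 ⊗ₜ MulOpposite.op b) z)) ∧
      (∀ n, e (ν.unit n) = pairHom hA X μ n) ∧
      ∀ y a z, e y (μ.indHom (a ⊗ₜ 1) z) = a * e y z := by
  obtain ⟨e, he, he_unit⟩ := ν.exists_ind_lift hB (precompAct A (rightPart μ.indHom))
    (pairHom hA X μ) (fun s n => LinearMap.ext fun z => pairHom_smul_left hA X μ n s z)
  have he_left (b : B) (y : ν.Ind) (z : μ.Ind) :
      e (ν.indHom (b ⊗ₜ 1) y) z = e y (μ.indHom (1 ⊗ₜ MulOpposite.op b) z) :=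
    LinearMap.congr_fun (he b y) z
  refine ⟨e, he_left, he_unit, fun y a z => ?_⟩
  induction y using ν.ind_induction hB with
  | add y y' hy hy' => rw [map_add, LinearMap.add_apply, LinearMap.add_apply, hy, hy', mul_add]
  | unit b n =>
    have h1 := LinearMap.congr_fun (leftPart_rightPart_commute μ.indHom a (MulOpposite.op b)) z
    rw [Module.End.mul_apply, Module.End.mul_apply, leftPart_apply,
      rightPart_apply] at h1
    rw [he_left, he_left, he_unit, ← h1, pairHom_left]

set_option maxHeartbeats 1000000 in
/-- If `α` is linear over `A □_H Aᵒᵖ`, then a pairing `F(N₁) × F(M₁) → A` that extends `α` and is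
left `A`-linear and `B`-balanced is also right `A`-linear: on the image of `M₁ ⊗ N₁` it is linear
over the cotensor product, which together with `A ⊗ 1` generates `A ⊗ Aᵒᵖ`. -/
theorem mul_unop_of_isBoxLinear (hA : IsRightFaithfullyFlatGalois k H A)
    (h : IsBoxLinear μ ν X.α) {e : ν.Ind →ₗ[k] μ.Ind →ₗ[k] A}
    (he_left : ∀ b y z, e (ν.indHom (b ⊗ₜ 1) y) z = e y (μ.indHom (1 ⊗ₜ MulOpposite.op b) z))
    (he_unit : ∀ n, e (ν.unit n) = pairHom hA X μ n)
    (he_A : ∀ y a z, e y (μ.indHom (a ⊗ₜ 1) z) = a * e y z) (a : Aᵐᵒᵖ) (n : N₁) (m : M₁) :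
    e (ν.indHom (1 ⊗ₜ a) (ν.unit n)) (μ.unit m) = X.pair m n * a.unop := by
  obtain ⟨τ, hτ, hα⟩ := h
  let E : IndTensor μ ν →ₗ[k] A := BalTensor.lift e.flip (fun b z y => (he_left b y z).symm)
  have E_tmul (z : μ.Ind) (y : ν.Ind) : E (BalTensor.tmul _ _ z y) = e y z :=
    BalTensor.lift_tmul _ _ _ _
  have E_unit (w) : E (unitTensor μ ν w) = X.α w := by
    induction w using BalTensor.induction with
    | zero => rw [map_zero, map_zero, map_zero, ZeroMemClass.coe_zero]
    | add x y hx hy => rw [map_add, map_add, map_add, Subalgebra.coe_add, hx, hy]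
    | tmul m n =>
      rw [X.α_tmul, ← pairHom_unit hA X μ, ← he_unit, ← E_tmul]
      rfl
  have E_left (a : A) (w) : E (indTensorAct μ ν (a ⊗ₜ 1) w) = a * E w := by
    induction w using BalTensor.induction with
    | zero => rw [map_zero, map_zero, mul_zero]
    | add y z hy hz => rw [map_add, map_add, map_add, hy, hz, mul_add]
    | tmul z y =>
      rw [indTensorAct_tmul, E_tmul, E_tmul, he_A, ← Algebra.TensorProduct.one_def, map_one,
        Module.End.one_apply]
  have E_act_unit (x : A ⊗[k] Aᵐᵒᵖ) (w) : E (indTensorAct μ ν x (unitTensor μ ν w)) =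
      AlgHom.mulLeftRight k A x (X.α w) := by
    induction x using envelo_induction (B := A) hA with
    | add x y hx hy =>
      rw [indTensorAct_add]
      exact (E.map_add _ _).trans ((congrArg₂ (· + ·) hx hy).trans
        (LinearMap.congr_fun (map_add (AlgHom.mulLeftRight k A) x y) (X.α w : A)).symm)
    | mul a t =>
      rw [indTensorAct_mul, E_left, ← hτ.map_act, E_unit, hα, mulLeftRight_mul]
  have h2 := E_act_unit (1 ⊗ₜ a) (tmulOver k (coinv k H B) m n)
  rw [unitTensor_tmul, indTensorAct_tmul, E_tmul, AlgHom.mulLeftRight_apply, X.α_tmul,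
    ← Algebra.TensorProduct.one_def, map_one, Module.End.one_apply, one_mul] at h2
  exact h2

set_option maxHeartbeats 1000000 in
/-- If `α` is linear over `A □_H Aᵒᵖ`, then it extends to an `(A, A)`-bimodule map
`F(M₁) ⊗_B F(N₁) → A`; hence the action on `N₁` is induced by that on `Hom(F(M₁), A)`. -/
theorem dualCompatible_of_isBoxLinear (hA : IsRightFaithfullyFlatGalois k H A)
    (hB : IsRightFaithfullyFlatGalois k H B) (h : IsBoxLinear μ ν X.α) :
    DualCompatible hA X μ ν := by
  obtain ⟨e, he_left, he_unit, he_A⟩ := exists_ind_lift_pairHom hA hB X μ ν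
  have he_right (a : Aᵐᵒᵖ) (y : ν.Ind) (z : μ.Ind) :
      e (ν.indHom (1 ⊗ₜ a) y) z = e y z * a.unop := by
    induction y using ν.ind_induction hB generalizing z with
    | add y y' hy hy' =>
      rw [map_add, map_add, map_add, LinearMap.add_apply, LinearMap.add_apply, hy, hy', add_mul]
    | unit b n =>
      have h1 := LinearMap.congr_fun (leftPart_rightPart_commute ν.indHom b a) (ν.unit n)
      rw [Module.End.mul_apply, Module.End.mul_apply, leftPart_apply,
        rightPart_apply] at h1
      rw [← h1, he_left, he_left]
      generalize μ.indHom (1 ⊗ₜ MulOpposite.op b) z = z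
      induction z using μ.ind_induction hA with
      | add z z' hz hz' => rw [map_add, map_add, hz, hz', add_mul]
      | unit a' m =>
        rw [he_A, he_A, mul_assoc, mul_unop_of_isBoxLinear hA h he_left he_unit he_A, he_unit,
          pairHom_unit]
  have he_act (x : B ⊗[k] Aᵐᵒᵖ) (y : ν.Ind) : e (ν.indHom x y) = homAct μ.indHom x (e y) := by
    induction x with
    | zero => rw [map_zero, map_zero, LinearMap.zero_apply, LinearMap.zero_apply, map_zero]
    | add x x' hx hx' =>
      rw [map_add (homAct μ.indHom), LinearMap.add_apply, ← hx, ← hx', ← map_add e,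
        ← LinearMap.add_apply, ← map_add ν.indHom]
    | tmul b a =>
      refine LinearMap.ext fun z => ?_
      rw [apply_tmul_eq, leftPart_apply, rightPart_apply, he_left, homAct_tmul, he_right]
  intro t n
  rw [← he_unit, ← ν.indHom_unit, he_act, he_unit]

end BoxLinear

end HopfMorita

end

theorem theorem5p9 {k H A B M₁ N₁ : Type u} [CommRing k] [Ring H] [HopfAlgebra k H]
    [HopfMorita.BijectiveAntipode k H] [Module.Projective k H]
    [Ring A] [Algebra k A] [HopfMorita.ComoduleAlgebra k H A]
    [Ring B] [Algebra k B] [HopfMorita.ComoduleAlgebra k H B]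
    (hA : HopfMorita.IsRightFaithfullyFlatGalois k H A)
    (hB : HopfMorita.IsRightFaithfullyFlatGalois k H B)
    [AddCommGroup M₁] [Module k M₁]
    [Module (HopfMorita.coinv k H A) M₁] [IsScalarTower k (HopfMorita.coinv k H A) M₁]
    [Module (HopfMorita.coinv k H B)ᵐᵒᵖ M₁] [IsScalarTower k (HopfMorita.coinv k H B)ᵐᵒᵖ M₁]
    [SMulCommClass (HopfMorita.coinv k H A) (HopfMorita.coinv k H B)ᵐᵒᵖ M₁]
    [AddCommGroup N₁] [Module k N₁]
    [Module (HopfMorita.coinv k H B) N₁] [IsScalarTower k (HopfMorita.coinv k H B) N₁]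
    [Module (HopfMorita.coinv k H A)ᵐᵒᵖ N₁] [IsScalarTower k (HopfMorita.coinv k H A)ᵐᵒᵖ N₁]
    [SMulCommClass (HopfMorita.coinv k H B) (HopfMorita.coinv k H A)ᵐᵒᵖ N₁]
    (X : HopfMorita.MoritaContext k (HopfMorita.coinv k H A) (HopfMorita.coinv k H B) M₁ N₁)
    (hX : X.IsStrict) (μ : HopfMorita.BoxModule k H A B M₁) :
    (∃! ν : HopfMorita.BoxModule k H B A N₁, X.IsBoxMorita μ ν ∧ X.IsStrict) ∧
      HopfMorita.HMoritaEquivalent k H A B := by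
  obtain ⟨ν, hν⟩ := HopfMorita.exists_dualCompatible hA μ hX
  have hμ := hν.swap hX hB
  refine ⟨⟨ν, ⟨⟨?_, ?_⟩, hX⟩, fun ν' hν' => ?_⟩, ?_⟩
  · exact HopfMorita.isBoxLinear_of_dualCompatible hX hν hμ
  · exact HopfMorita.isBoxLinear_of_dualCompatible (X := X.swap) hX.swap hμ hν
  · exact (HopfMorita.dualCompatible_of_isBoxLinear hA hB hν'.1.α_linear).unique hX hν
  · exact HopfMorita.hMoritaEquivalent_of_dualCompatible hX hν hμ
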